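/- Let $a\ge 0$ be an integer. There is a constant $B$ (depending only on $a$) such that for every integer $k\ge 0$ there are constants $c>0$ and $K$ (depending only on $a$ and $k$) and a randomized synchronous message-passing algorithm $\mathcal A$ (the code of a node may depend on $n$) that, for all $n\ge 3$, runs in at most $K\log\log n$ rounds and sends messages of at most $B\log n$ bits (the $\mathsf{CONGEST}$ model), with the following guarantee. Let $G$ be a graph with $n$ nodes and maximum degree $\Delta$, whose nodes have distinct IDs in $\{0,\dots,n^a-1\}$, and let $\varepsilon\le 1/15$ satisfy $\varepsilon\Delta>c\log^2 n$. Call a node set $C$ an almost-clique if $(1-\varepsilon)\Delta\le |C|\le(1+\varepsilon)\Delta$ and every $v\in C$ has at least $(1-\varepsilon)\Delta$ neighbors in $C$. Let any family of pairwise disjoint almost-cliques be given (for instance a single one, or those of an almost-clique decomposition), with distinct AC-IDs in $\{0,\dots,n^a-1\}$ and with a leader node $w_C\in C$ in each member $C$. Initially each node knows its ID, the IDs of its neighbors, the AC-ID of the member that contains it (if any), whether it is its leader, and a private random seed, uniform on a finite set and independent of the seeds of the other nodes. Then, with probability at least $1-n^{-k}$, algorithm $\mathcal A$ computes a clique overlay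 of congestion at most $2$ for every member $C$ of the family. Here a clique overlay of $C$ is a collection $O$ of paths of length $2$ in $G[C]$ that contains a path between any two distinct non-adjacent nodes of $C$. Its congestion is the maximum, over the edges $e$ of $G$, of the number of occurrences of $e$ in paths of $O$. The algorithm computes $O$ if each node $u\in C$ outputs a partial map on IDs, defined exactly at the IDs of the non-neighbors $v\ne u$ of $u$ in $C$, such that for every non-edge $\{u,v\}$ of $G[C]$ there is a path $u - w - v$ in $O$ for which $u$ outputs $w$ at $v$, and $v$ outputs $w$ at $u$. -/

import Mathlib

/-- A randomized synchronous message-passing algorithm with `msgBits`-bit messages, as a piece of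
code that is run by every node. Local computation is unrestricted.
* `init`: the initial state of a node, from its own ID, the IDs of its neighbours, its local input
  and its private random seed (uniform on the finite set `Seed`, independent between nodes);
* `send`: the message sent in a round to the neighbour with the given ID;
* `recv`: the new state, from the old one and the set of received pairs
  (ID of the sending neighbour, message);
* `rounds`: the number of communication rounds after which `output` is read off. -/
structure CongestAlgorithm (In Out : Type) where
  Seed : Type
  [seedFintype : Fintype Seed]
  [seedNonempty : Nonempty Seed]
  State : Type
  msgBits : ℕ
  rounds : ℕ
  init : ℕ → Finset ℕ → In → Seed → State
  send : State → ℕ → (Fin msgBits → Bool)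
  recv : State → Finset (ℕ × (Fin msgBits → Bool)) → State
  output : State → Out

attribute [instance] CongestAlgorithm.seedFintype CongestAlgorithm.seedNonempty

namespace CongestAlgorithm

variable {In Out V : Type} [Fintype V] [DecidableEq V]

/-- The state of node `v` after `t` rounds, in the network `G` with node IDs `id`, local inputs
`input` and private random seeds `ω`. -/
def stateAt (A : CongestAlgorithm In Out) (G : SimpleGraph V) [DecidableRel G.Adj]
    (id : V ↪ ℕ) (input : V → In) (ω : V → A.Seed) : ℕ → V → A.State
  | 0, v => A.init (id v) ((G.neighborFinset v).map id) (input v) (ω v)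
  | t + 1, v =>
      A.recv (A.stateAt G id input ω t v)
        ((G.neighborFinset v).image
          fun u => (id u, A.send (A.stateAt G id input ω t u) (id v)))

/-- The output of node `v` at the end of the execution. -/
def run (A : CongestAlgorithm In Out) (G : SimpleGraph V) [DecidableRel G.Adj]
    (id : V ↪ ℕ) (input : V → In) (ω : V → A.Seed) (v : V) : Out :=
  A.output (A.stateAt G id input ω A.rounds v)

/-- The probability of an event when the nodes draw independent uniform seeds. -/
noncomputable def prob (A : CongestAlgorithm In Out) (E : Set (V → A.Seed)) : ℝ :=
  (E.ncard : ℝ) / (Fintype.card (V → A.Seed) : ℝ)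

end CongestAlgorithm

section CliqueOverlay

variable {V : Type} [Fintype V] [DecidableEq V]

/-- `C` is an `ε`-almost-clique of `G`, where `Δ = G.maxDegree`:
`(1 - ε)Δ ≤ |C| ≤ (1 + ε)Δ`, and `|N(v) ∩ C| ≥ (1 - ε)Δ` for every `v ∈ C`. -/
def IsAlmostClique (G : SimpleGraph V) [DecidableRel G.Adj] (ε : ℝ) (C : Finset V) : Prop :=
  (1 - ε) * (G.maxDegree : ℝ) ≤ (C.card : ℝ) ∧
  (C.card : ℝ) ≤ (1 + ε) * (G.maxDegree : ℝ) ∧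
  ∀ v ∈ C, (1 - ε) * (G.maxDegree : ℝ) ≤ ((G.neighborFinset v ∩ C).card : ℝ)

/-- `u` and `v` are distinct non-adjacent nodes of `C`. -/
def IsNonEdge (G : SimpleGraph V) (C : Finset V) (u v : V) : Prop :=
  u ∈ C ∧ v ∈ C ∧ u ≠ v ∧ ¬ G.Adj u v

/-- The pair `(s(u, v), w)` stands for the undirected path `u - w - v`. It is a path of length 2
in `G[C]` if `u ≠ v`, all three nodes are in `C`, and `w` is adjacent to `u` and `v`. -/
def IsTwoPath (G : SimpleGraph V) (C : Finset V) (p : Sym2 V × V) : Prop :=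
  ¬ p.1.IsDiag ∧ p.2 ∈ C ∧ ∀ x ∈ p.1, x ∈ C ∧ G.Adj x p.2

/-- A clique overlay of `C`: a collection of length-2 paths in `G[C]` that contains a path between
any two non-adjacent nodes of `C`. -/
def IsCliqueOverlay (G : SimpleGraph V) (C : Finset V) (O : Finset (Sym2 V × V)) : Prop :=
  (∀ p ∈ O, IsTwoPath G C p) ∧
  ∀ u v, IsNonEdge G C u v → ∃ w, (s(u, v), w) ∈ O

/-- The number of occurrences of the edge `e` in the collection `O` of length-2 paths. -/
def edgeOccurrences (O : Finset (Sym2 V × V)) (e : Sym2 V) : ℕ :=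
  (O.filter fun p => ∃ x : V, x ∈ p.1 ∧ e = s(x, p.2)).card

/-- The congestion of a collection of length-2 paths: the maximum number of occurrences of an edge
of `G` in it. -/
def overlayCongestion (G : SimpleGraph V) [DecidableRel G.Adj] (O : Finset (Sym2 V × V)) : ℕ :=
  G.edgeFinset.sup (edgeOccurrences O)

/-- The outputs `out` of the nodes describe the overlay `O` of `C`. The output of a node `u ∈ C` is
a partial map from IDs to IDs, defined exactly at the IDs of the non-neighbours of `u` in `C`. For
every non-edge `{u, v}` of `G[C]`, both `u` and `v` know the node `w` that forwards messages
between them in `O`. -/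
def KnowsOverlay (G : SimpleGraph V) (id : V ↪ ℕ) (C : Finset V) (O : Finset (Sym2 V × V))
    (out : V → ℕ → Option ℕ) : Prop :=
  (∀ u v, IsNonEdge G C u v →
    ∃ w, (s(u, v), w) ∈ O ∧ out u (id v) = some (id w) ∧ out v (id u) = some (id w)) ∧
  ∀ u ∈ C, ∀ i : ℕ, (∀ v, IsNonEdge G C u v → id v ≠ i) → out u i = none

/-- The local input of a node: the AC-ID of the almost-clique that contains it (`none` if there is
none), and whether it is the leader of that almost-clique. -/
structure CliqueInput where
  acId : Option ℕ
  isLeader : Bool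

/-- The set of nodes with AC-ID `i`. -/
def acNodes (input : V → CliqueInput) (i : ℕ) : Finset V :=
  Finset.univ.filter fun v => (input v).acId = some i

end CliqueOverlay

/-!
Any two nodes of an almost-clique with `N` nodes have a common neighbour in it, so that messages to
and from the leader can be relayed, and in a constant number of rounds the leader can name the nodes
by the labels `0, …, N - 1`. From then on a node can draw a uniformly random node of the cluster.

In each phase, the end with the smaller label draws a random middle node for every non-edge that is
still without one, and asks it to connect the two ends. For a non-edge `{u, v}`, a middle node fails
only if it is a non-neighbour of `u` or `v`, serves one of them already, or is tried in the same
phase for another non-edge at `u` or `v`. Each of these sets has at most `N / 8` elements for each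
of the two ends, and none depends on the trial itself if ties are broken by an order of the trials,
so the trial fails with probability at most `3 / 4`, whatever the earlier trials were. Hence after
`O(log log n)` phases, with high probability, no node has more than about `N / log n` non-edges
left. At that point there is room for `O(log n)` simultaneous trials for each of them, and with high
probability one of these succeeds for every non-edge.

A middle node serves every node at most once. An edge `{u, w}` is therefore used at most once with
middle node `w` and at most once with middle node `u`, which makes the congestion at most 2.
-/

namespace CliqueOverlay

open Finset

section UniformProbability

variable {Ω Ω' J : Type*}

/-- The probability of the event `E` under the uniform distribution on the finite type `Ω`. -/
noncomputable def unifProb (E : Set Ω) : ℝ := E.ncard / Nat.card Ω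

@[simp]
theorem unifProb_empty : unifProb (∅ : Set Ω) = 0 := by simp [unifProb]

theorem unifProb_univ [Finite Ω] [Nonempty Ω] : unifProb (Set.univ : Set Ω) = 1 := by
  simp [unifProb, Set.ncard_univ, Nat.card_pos.ne']

theorem unifProb_preimage_equiv (e : Ω ≃ Ω') (E : Set Ω') :
    unifProb (e ⁻¹' E) = unifProb E := by
  rw [unifProb, unifProb, Nat.card_congr e, ← e.image_symm_eq_preimage,
    Set.ncard_image_of_injective _ e.symm.injective]

theorem unifProb_mono [Finite Ω] {E F : Set Ω} (h : E ⊆ F) : unifProb E ≤ unifProb F := by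
  unfold unifProb
  gcongr
  exact F.toFinite

theorem unifProb_union_le (E F : Set Ω) : unifProb (E ∪ F) ≤ unifProb E + unifProb F := by
  rw [unifProb, unifProb, unifProb, ← add_div]
  gcongr
  exact_mod_cast Set.ncard_union_le E F

theorem unifProb_biUnion_le (s : Finset J) (E : J → Set Ω) :
    unifProb (⋃ j ∈ s, E j) ≤ ∑ j ∈ s, unifProb (E j) := by
  classical
  induction s using Finset.induction_on with
  | empty => simp
  | insert j s hj ih =>
    rw [set_biUnion_insert, sum_insert hj]
    exact (unifProb_union_le _ _).trans (by gcongr)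

theorem unifProb_compl [Finite Ω] [Nonempty Ω] (E : Set Ω) : unifProb Eᶜ = 1 - unifProb E := by
  rw [eq_sub_iff_add_eq', ← unifProb_univ (Ω := Ω), unifProb, unifProb, unifProb, ← add_div,
    Set.ncard_univ, ← Set.ncard_add_ncard_compl E, Nat.cast_add]

theorem unifProb_le_mul_of_fiber_le [Finite Ω] [Finite Ω'] {P : Set Ω} {E : Set (Ω × Ω')} {q : ℝ}
    (hE : ∀ p ∈ E, p.1 ∈ P) (hq : ∀ x ∈ P, unifProb {y | (x, y) ∈ E} ≤ q) :
    unifProb E ≤ q * unifProb P := by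
  have hcard : E.ncard = ∑ x ∈ P.toFinite.toFinset, {y | (x, y) ∈ E}.ncard := by
    classical
    rw [Set.ncard_eq_toFinset_card E,
      card_eq_sum_card_fiberwise (f := Prod.fst) (t := P.toFinite.toFinset)
        fun p hp => by simpa using hE p (by simpa using hp)]
    refine sum_congr rfl fun x _ => ?_
    rw [← Set.ncard_coe_finset,
      ← Set.ncard_image_of_injective {y | (x, y) ∈ E} (Prod.mk_right_injective x)]
    congr 1
    ext ⟨z, y⟩
    simp only [coe_filter, Set.Finite.mem_toFinset, Set.mem_ofPred_eq, Set.mem_image,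
      Prod.mk.injEq]
    grind
  have hsum : (E.ncard : ℝ) / Nat.card Ω' ≤ P.ncard * q := by
    rw [hcard, Nat.cast_sum, sum_div, Set.ncard_eq_toFinset_card P, ← nsmul_eq_mul]
    exact sum_le_card_nsmul _ _ _ fun x hx => hq x (by simpa using hx)
  calc unifProb E = E.ncard / Nat.card Ω' / Nat.card Ω := by
        rw [unifProb, Nat.card_prod, Nat.cast_mul, div_div, mul_comm]
    _ ≤ P.ncard * q / Nat.card Ω := by gcongr
    _ = q * unifProb P := by rw [unifProb]; ring

theorem unifProb_preimage_fst [Finite Ω'] [Nonempty Ω'] (E : Set Ω) :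
    unifProb (Prod.fst ⁻¹' E : Set (Ω × Ω')) = unifProb E := by
  rw [← Set.prod_univ, unifProb, Set.ncard_prod, Set.ncard_univ, Nat.card_prod]
  push_cast
  exact mul_div_mul_right _ _ (by exact_mod_cast Nat.card_pos.ne')

end UniformProbability

section Resampling

variable {ι α J β : Type*} [Finite ι] [DecidableEq ι] [Finite α] [Nonempty α] {q : ℝ}

-- Exchanging `ω i` with an independent fresh value preserves the uniform distribution.
theorem unifProb_inter_coord_mem_le (i : ι) {P : Set (ι → α)} {bad : (ι → α) → Set α}
    (hP : ∀ ω a, Function.update ω i a ∈ P ↔ ω ∈ P)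
    (hbad : ∀ ω a, bad (Function.update ω i a) = bad ω) (hq : ∀ ω, unifProb (bad ω) ≤ q) :
    unifProb (P ∩ {ω | ω i ∈ bad ω}) ≤ q * unifProb P := by
  have hinv : Function.Involutive fun p : (ι → α) × α => (Function.update p.1 i p.2, p.1 i) :=
    fun p => by simp
  have hexchange : (Prod.fst ⁻¹' (P ∩ {ω | ω i ∈ bad ω}) : Set ((ι → α) × α)) =
      hinv.toPerm ⁻¹' {p | p.1 ∈ P ∧ p.2 ∈ bad p.1} := by
    ext p
    simp [hP, hbad]
  rw [← unifProb_preimage_fst (Ω' := α), hexchange, unifProb_preimage_equiv]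
  exact unifProb_le_mul_of_fiber_le (fun p hp => hp.1)
    fun ω _ => (unifProb_mono fun a ha => ha.2).trans (hq ω)

theorem unifProb_forall_coord_mem_le [LinearOrder β] (key : J → β) {κ : J → ι}
    {bad : J → (ι → α) → Set α} (hq0 : 0 ≤ q) {S : Finset J} (hκ : Set.InjOn κ S)
    (hbad : ∀ i ∈ S, ∀ j ∈ S, key i ≤ key j → ∀ ω a,
      bad i (Function.update ω (κ j) a) = bad i ω)
    (hq : ∀ i ∈ S, ∀ ω, unifProb (bad i ω) ≤ q) :
    unifProb {ω : ι → α | ∀ i ∈ S, ω (κ i) ∈ bad i ω} ≤ q ^ #S := by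
  classical
  induction S using Finset.induction_on_max_value key with
  | empty => simp [unifProb_univ]
  | insert j S hj hmax ih =>
    simp only [coe_insert, forall_mem_insert] at hκ hbad hq ⊢
    have hindep : ∀ ω a, (∀ i ∈ S, Function.update ω (κ j) a (κ i) ∈
        bad i (Function.update ω (κ j) a)) ↔ ∀ i ∈ S, ω (κ i) ∈ bad i ω := by
      refine fun ω a => forall₂_congr fun i hi => ?_
      have hne : κ i ≠ κ j := fun h => hj (hκ (by simp [hi]) (by simp) h ▸ hi)
      rw [(hbad.2 i hi).1 (hmax i hi), Function.update_of_ne hne]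
    calc unifProb {ω : ι → α | ω (κ j) ∈ bad j ω ∧ ∀ i ∈ S, ω (κ i) ∈ bad i ω}
        = unifProb ({ω | ∀ i ∈ S, ω (κ i) ∈ bad i ω} ∩ {ω | ω (κ j) ∈ bad j ω}) := by
          rw [Set.inter_comm]; rfl
      _ ≤ q * unifProb {ω | ∀ i ∈ S, ω (κ i) ∈ bad i ω} :=
          unifProb_inter_coord_mem_le (κ j) hindep (hbad.1.1 le_rfl) hq.1
      _ ≤ q * q ^ #S := by
          gcongr
          exact ih (hκ.mono (Set.subset_insert _ _)) (fun i hi => (hbad.2 i hi).2) hq.2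
      _ = q ^ #(insert j S) := by rw [card_insert_of_notMem hj, pow_succ']

end Resampling

/-- The law of `col a`, for a uniform `a`, is the uniform distribution on `{0, …, N - 1}`. Only
the upper bound on the probabilities is recorded, as it implies the lower one. -/
def IsUniformBelow {α : Type*} (N : ℕ) (col : α → ℕ) : Prop :=
  (∀ a, col a < N) ∧ ∀ B : Finset ℕ, unifProb {a | col a ∈ B} * N ≤ #B

theorem isUniformBelow_mod {M N : ℕ} (hN : 0 < N) (hNM : N ∣ M) :
    IsUniformBelow N fun a : Fin M => (a : ℕ) % N := by
  refine ⟨fun a => Nat.mod_lt _ hN, fun B => ?_⟩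
  obtain ⟨q, rfl⟩ := hNM
  have hcard : {a : Fin (N * q) | a.val % N ∈ B}.ncard ≤ #(B ×ˢ range q) := by
    rw [Set.ncard_eq_toFinset_card']
    refine card_le_card_of_injOn (fun a => (a.val % N, a.val / N)) ?_ ?_
    · intro a ha
      simpa using ⟨by simpa using ha, Nat.div_lt_of_lt_mul a.2⟩
    · intro a _ b _ h
      simp only [Prod.mk.injEq] at h
      rw [Fin.ext_iff, ← Nat.div_add_mod a.val N, ← Nat.div_add_mod b.val N, h.1, h.2]
  rw [card_product, card_range] at hcard
  rcases q.eq_zero_or_pos with rfl | hq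
  · simp [unifProb]
  · rw [unifProb, Nat.card_fin, Nat.cast_mul, div_mul_eq_mul_div, div_le_iff₀ (by positivity)]
    calc ({a : Fin (N * q) | a.val % N ∈ B}.ncard : ℝ) * N ≤ (#B * q : ℕ) * N := by gcongr
      _ = #B * (N * q) := by push_cast; ring

section NonNeighbours

variable {V : Type} {G : SimpleGraph V} {C : Finset V} {u v x : V}

open scoped Classical in
/-- The nodes of `C` that are not adjacent to `x`. They include `x` itself if `x ∈ C`. -/
noncomputable def nonNbrs (G : SimpleGraph V) (C : Finset V) (x : V) : Finset V :=
  {z ∈ C | ¬ G.Adj x z}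

/-- Every node of `C` is adjacent to at least seven eighths of `C`. This is all that the analysis
uses about almost-cliques. -/
def IsDense (G : SimpleGraph V) (C : Finset V) : Prop :=
  ∀ x ∈ C, 8 * #(nonNbrs G C x) ≤ #C

theorem mem_nonNbrs : v ∈ nonNbrs G C x ↔ v ∈ C ∧ ¬ G.Adj x v := by
  classical simp [nonNbrs]

theorem isNonEdge_comm : IsNonEdge G C u v ↔ IsNonEdge G C v u := by
  unfold IsNonEdge
  rw [G.adj_comm, ne_comm]
  tauto

theorem IsDense.exists_common_neighbor (hC : IsDense G C) (hu : u ∈ C) (hv : v ∈ C) :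
    ∃ z ∈ C, G.Adj u z ∧ G.Adj z v := by
  classical
  by_contra! h
  have hsub : C ⊆ nonNbrs G C u ∪ nonNbrs G C v := fun z hz => by
    simp only [mem_union, mem_nonNbrs, hz, true_and, G.adj_comm v z]
    tauto
  have := (card_le_card hsub).trans (card_union_le _ _)
  have := hC u hu
  have := hC v hv
  have := card_pos.2 ⟨u, hu⟩
  omega

end NonNeighbours

section Least

variable {S : Set ℕ} {v : ℕ}

open scoped Classical in
/-- The least element of a set of natural numbers, if there is any. -/
noncomputable def least (S : Set ℕ) : Option ℕ :=
  if S.Nonempty then some (sInf S) else none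

theorem least_eq_some_iff : least S = some v ↔ IsLeast S v := by
  unfold least
  split_ifs with h
  · rw [Option.some_inj]
    exact ⟨fun e => e ▸ ⟨Nat.sInf_mem h, fun _ => Nat.sInf_le⟩, IsLeast.csInf_eq⟩
  · simp only [false_iff]
    exact fun hv => h hv.nonempty

theorem least_eq_none_iff : least S = none ↔ S = ∅ := by
  simp [least, Set.not_nonempty_iff_eq_empty]

theorem least_mem (h : least S = some v) : v ∈ S := (least_eq_some_iff.1 h).1

end Least

section Rules

/-- The nodes `v` to which node `u` would like to be connected by node `w`, where `u` has the
neighbours `nbr`, the middle nodes `mid` so far, and tries the middle nodes `tries v` for `v`. Only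
the smaller end `u` of a non-edge `{u, v}` takes care of it. -/
def wishes (N u : ℕ) (nbr : Set ℕ) (mid : ℕ → Option ℕ) (tries : ℕ → Finset ℕ) (w : ℕ) : Set ℕ :=
  {v | u < v ∧ v < N ∧ v ∉ nbr ∧ mid v = none ∧ w ∈ tries v}

/-- A node with neighbours `nbr`, of which it serves those in `busy` already, and which receives
the requests `req`, connects `u` to `v` at the request of `u`. -/
def Accepts (nbr busy : Set ℕ) (req : ℕ → ℕ → Prop) (u v : ℕ) : Prop :=
  req u v ∧ v ∈ nbr ∧ u ∉ busy ∧ v ∉ busy ∧ ∀ u' < u, ∀ v', req u' v' → v' ≠ u ∧ v' ≠ v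

/-- The symmetric closure of `Accepts`. -/
def Connects (nbr busy : Set ℕ) (req : ℕ → ℕ → Prop) (u v : ℕ) : Prop :=
  Accepts nbr busy req u v ∨ Accepts nbr busy req v u

variable {N u v w x z z' : ℕ} {nbr busy : Set ℕ} {req : ℕ → ℕ → Prop}

theorem connects_comm : Connects nbr busy req u v ↔ Connects nbr busy req v u := or_comm

theorem wishes_congr {mid : ℕ → Option ℕ} {tries tries' : ℕ → Finset ℕ}
    (h : ∀ v, u < v → v < N → tries v = tries' v) :
    wishes N u nbr mid tries w = wishes N u nbr mid tries' w := by
  ext v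
  simp only [wishes, Set.mem_ofPred_eq]
  grind

theorem Connects.unique (hlt : ∀ u v, req u v → u < v)
    (hreq : ∀ u v v', req u v → req u v' → v = v')
    (h : Connects nbr busy req x z) (h' : Connects nbr busy req x z') : z = z' := by
  rcases h with ⟨h, -, -, -, hfirst⟩ | ⟨h, -, -, -, hfirst⟩ <;>
    rcases h' with ⟨h', -, -, -, hfirst'⟩ | ⟨h', -, -, -, hfirst'⟩
  · exact hreq _ _ _ h h'
  · exact absurd rfl (hfirst _ (hlt _ _ h') _ h').1
  · exact absurd rfl (hfirst' _ (hlt _ _ h) _ h).1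
  · rcases lt_trichotomy z z' with hz | hz | hz
    · exact absurd rfl (hfirst' _ hz _ h).2
    · exact hz
    · exact absurd rfl (hfirst _ hz _ h').2

end Rules

/-- A partial overlay of a graph on the nodes `0, …, N - 1`: `mid u v` is the middle node of the
path chosen for the non-edge `{u, v}`, if any, and `serves w` are the nodes to which `w` has
committed itself as a middle node. -/
structure PartialOverlay where
  serves : ℕ → Set ℕ
  mid : ℕ → ℕ → Option ℕ

namespace PartialOverlay

section Phase

variable (N : ℕ) (H : SimpleGraph ℕ) (s : PartialOverlay) (tries : ℕ → ℕ → Finset ℕ)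

/-- The nodes to which `u` would like to be connected by `w` in the current phase. -/
def wishesOf (u w : ℕ) : Set ℕ := wishes N u (H.neighborSet u) (s.mid u) (tries u) w

/-- Node `w` is asked by `u` to connect `u` to `v`. -/
def Requests (w u v : ℕ) : Prop := H.Adj w u ∧ IsLeast (s.wishesOf N H tries u w) v

/-- Node `w` connects `u` and `v` in the current phase. -/
def ConnectsAt (w : ℕ) : ℕ → ℕ → Prop :=
  Connects (H.neighborSet w) (s.serves w) (s.Requests N H tries w)

/-- The partial overlay after one more phase. -/
noncomputable def step : PartialOverlay where
  serves w := s.serves w ∪ {x | ∃ z, s.ConnectsAt N H tries w x z}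
  mid u v := (s.mid u v).or (least {c | s.ConnectsAt N H tries c u v})

/-- The partial overlay after `t` phases, from the middle nodes `tries t u v` that are tried for
each non-edge `{u, v}`, `u < v`, in phase `t`. -/
noncomputable def after (tries : ℕ → ℕ → ℕ → Finset ℕ) : ℕ → PartialOverlay
  | 0 => ⟨fun _ => ∅, fun _ _ => none⟩
  | t + 1 => (after tries t).step N H (tries t)

/-- The invariants of the phases. -/
structure IsValid : Prop where
  mid_comm : ∀ u v, s.mid u v = s.mid v u
  isNonEdge : ∀ {u v w}, s.mid u v = some w → IsNonEdge H (range N) u v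
  adj : ∀ {u v w}, s.mid u v = some w → H.Adj w u
  mem_serves : ∀ {u v w}, s.mid u v = some w → u ∈ s.serves w
  mid_inj : ∀ {u v v' w}, s.mid u v = some w → s.mid u v' = some w → v = v'

open scoped Classical in
/-- The other ends of the non-edges at `x` without a middle node. -/
noncomputable def uncoloured (x : ℕ) : Finset ℕ :=
  {z ∈ range N | IsNonEdge H (range N) x z ∧ s.mid x z = none}

open scoped Classical in
/-- The middle nodes that may fail for the non-edge `{u, v}`, `u < v`. They depend only on the
trials that come before those for `{u, v}`. -/
noncomputable def failing (u v : ℕ) : Finset ℕ :=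
  {c ∈ range N | ¬ H.Adj c u ∨ ¬ H.Adj c v ∨ u ∈ s.serves c ∨ v ∈ s.serves c ∨
    (∃ v' < v, v' ∈ s.wishesOf N H tries u c) ∨
    ∃ u' < u, u ∈ s.wishesOf N H tries u' c ∨ v ∈ s.wishesOf N H tries u' c}

open scoped Classical in
/-- The nodes that serve `x`. -/
noncomputable def servers (x : ℕ) : Finset ℕ := {c ∈ range N | x ∈ s.serves c}

open scoped Classical in
/-- The middle nodes tried for the non-edges at `x`. -/
noncomputable def triedAt (x : ℕ) : Finset ℕ :=
  {c ∈ range N | ∃ z, z ∈ s.wishesOf N H tries x c ∨ x ∈ s.wishesOf N H tries z c}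

end Phase

variable {N L : ℕ} {H : SimpleGraph ℕ} {s : PartialOverlay} {u v w x z z' c : ℕ}

section Step

variable {tries tries' : ℕ → ℕ → Finset ℕ}

theorem mem_uncoloured :
    z ∈ s.uncoloured N H x ↔ IsNonEdge H (range N) x z ∧ s.mid x z = none := by
  simp only [uncoloured, mem_filter, and_iff_right_iff_imp]
  exact fun h => h.1.2.1

theorem mem_wishesOf : v ∈ s.wishesOf N H tries u w ↔
    u < v ∧ IsNonEdge H (range N) u v ∧ s.mid u v = none ∧ w ∈ tries u v := by
  simp only [wishesOf, wishes, IsNonEdge, Set.mem_ofPred_eq, SimpleGraph.mem_neighborSet, mem_range]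
  grind

theorem step_congr (h : ∀ u v, u < v → v < N → tries u v = tries' u v) :
    s.step N H tries = s.step N H tries' := by
  have hwishes : s.wishesOf N H tries = s.wishesOf N H tries' :=
    funext₂ fun u w => wishes_congr (h u)
  have hrequests : s.Requests N H tries = s.Requests N H tries' := by
    unfold Requests
    rw [hwishes]
  unfold step ConnectsAt
  rw [hrequests]

theorem failing_congr
    (h : ∀ u' v', u' < v' → v' < N → u' < u ∨ u' = u ∧ v' < v → tries u' v' = tries' u' v') :
    s.failing N H tries u v = s.failing N H tries' u v := by
  have hbefore : ∀ u' v', u' < u ∨ u' = u ∧ v' < v → ∀ c,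
      (v' ∈ s.wishesOf N H tries u' c ↔ v' ∈ s.wishesOf N H tries' u' c) := by
    intro u' v' huv c
    simp only [wishesOf, wishes, Set.mem_ofPred_eq]
    grind
  unfold failing
  grind

theorem connectsAt_comm : s.ConnectsAt N H tries w u v ↔ s.ConnectsAt N H tries w v u :=
  connects_comm

theorem ConnectsAt.unique (h : s.ConnectsAt N H tries w x z)
    (h' : s.ConnectsAt N H tries w x z') : z = z' :=
  Connects.unique (fun _ _ hr => hr.2.1.1) (fun _ _ _ hr hr' => hr.2.unique hr'.2) h h'

theorem IsValid.of_connectsAt (hs : s.IsValid N H) (h : s.ConnectsAt N H tries c u v) :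
    IsNonEdge H (range N) u v ∧ H.Adj c u ∧ u ∉ s.serves c ∧ s.mid u v = none ∧
      c ∈ tries (min u v) (max u v) := by
  rcases h with ⟨⟨hcu, hwish, -⟩, -, hu, -⟩ | ⟨⟨-, hwish, -⟩, hcu, -, hu, -⟩ <;>
    obtain ⟨hlt, hne, hmid, hc⟩ := mem_wishesOf.1 hwish
  · rw [min_eq_left hlt.le, max_eq_right hlt.le]
    exact ⟨hne, hcu, hu, hmid, hc⟩
  · rw [min_eq_right hlt.le, max_eq_left hlt.le]
    exact ⟨isNonEdge_comm.1 hne, hcu, hu, hs.mid_comm u v ▸ hmid, hc⟩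

theorem step_mid_eq_none_iff : (s.step N H tries).mid u v = none ↔
    s.mid u v = none ∧ ∀ c, ¬ s.ConnectsAt N H tries c u v := by
  simp [step, Option.or_eq_none_iff, least_eq_none_iff, Set.eq_empty_iff_forall_notMem]

theorem of_step_mid_eq_some (h : (s.step N H tries).mid u v = some w) :
    s.mid u v = some w ∨ s.ConnectsAt N H tries w u v := by
  rcases Option.or_eq_some_iff.1 h with h | ⟨-, h⟩
  · exact Or.inl h
  · exact Or.inr (least_mem h)

theorem IsValid.step (hs : s.IsValid N H) : (s.step N H tries).IsValid N H where
  mid_comm u v := by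
    simp only [PartialOverlay.step, hs.mid_comm u v, connectsAt_comm (u := u) (v := v)]
  isNonEdge h := (of_step_mid_eq_some h).elim hs.isNonEdge fun h => (hs.of_connectsAt h).1
  adj h := (of_step_mid_eq_some h).elim hs.adj fun h => (hs.of_connectsAt h).2.1
  mem_serves h := (of_step_mid_eq_some h).imp hs.mem_serves fun h => ⟨_, h⟩
  mid_inj h h' := by
    rcases of_step_mid_eq_some h with h | h <;> rcases of_step_mid_eq_some h' with h' | h'
    · exact hs.mid_inj h h'
    · exact absurd (hs.mem_serves h) (hs.of_connectsAt h').2.2.1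
    · exact absurd (hs.mem_serves h') (hs.of_connectsAt h).2.2.1
    · exact h.unique h'

theorem mem_failing_of_step_mid_eq_none (huv : u < v) (hne : IsNonEdge H (range N) u v)
    (hc : c ∈ tries u v) (hcN : c < N) (h : (s.step N H tries).mid u v = none) :
    c ∈ s.failing N H tries u v := by
  obtain ⟨hmid, hnot⟩ := step_mid_eq_none_iff.1 h
  by_contra hc'
  simp only [failing, mem_filter, mem_range, hcN, true_and, not_or, not_not, not_exists,
    not_and] at hc'
  obtain ⟨hcu, hcv, hu, hv, hfirst, hsmaller⟩ := hc'
  have hrequest : s.Requests N H tries c u v :=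
    ⟨hcu, mem_wishesOf.2 ⟨huv, hne, hmid, hc⟩, fun v' hv' => not_lt.1 fun hlt => hfirst v' hlt hv'⟩
  refine hnot c (Or.inl ⟨hrequest, hcv, hu, hv, ?_⟩)
  rintro u' hu' v' ⟨-, hv', -⟩
  exact ⟨fun e => (hsmaller u' hu').1 (e ▸ hv'), fun e => (hsmaller u' hu').2 (e ▸ hv')⟩

theorem card_servers_le (hs : s.IsValid N H)
    (hserves : ∀ w x, x ∈ s.serves w → ∃ z, s.mid x z = some w) :
    #(s.servers N x) ≤ #(nonNbrs H (range N) x) := by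
  refine card_le_card_of_surjOn (fun z => (s.mid x z).getD 0) fun c hc => ?_
  obtain ⟨z, hz⟩ := hserves c x (by classical exact (mem_filter.1 hc).2)
  obtain ⟨-, hzN, -, hxz⟩ := hs.isNonEdge hz
  exact ⟨z, mem_nonNbrs.2 ⟨hzN, hxz⟩, by simp [hz]⟩

theorem card_triedAt_le (hs : s.IsValid N H) (hL : ∀ u v, #(tries u v) ≤ L) :
    #(s.triedAt N H tries x) ≤ #(s.uncoloured N H x) * L := by
  have hsub : s.triedAt N H tries x ⊆
      (s.uncoloured N H x).biUnion fun z => tries (min x z) (max x z) := by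
    intro c hc
    simp only [triedAt, mem_filter, mem_wishesOf] at hc
    simp only [mem_biUnion, mem_uncoloured]
    obtain ⟨-, z, ⟨hlt, hne, hmid, hc⟩ | ⟨hlt, hne, hmid, hc⟩⟩ := hc
    · exact ⟨z, ⟨hne, hmid⟩, by rwa [min_eq_left hlt.le, max_eq_right hlt.le]⟩
    · exact ⟨z, ⟨isNonEdge_comm.1 hne, hs.mid_comm x z ▸ hmid⟩,
        by rwa [min_eq_right hlt.le, max_eq_left hlt.le]⟩
  exact (card_le_card hsub).trans (card_biUnion_le_card_mul _ _ _ fun z _ => hL _ _)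

theorem failing_subset : s.failing N H tries u v ⊆
    (nonNbrs H (range N) u ∪ nonNbrs H (range N) v) ∪ (s.servers N u ∪ s.servers N v) ∪
      (s.triedAt N H tries u ∪ s.triedAt N H tries v) := by
  classical
  intro c hc
  obtain ⟨hcN, hc⟩ := mem_filter.1 hc
  simp only [mem_union, mem_nonNbrs, servers, triedAt, mem_filter, hcN, true_and, H.adj_comm _ c]
  rcases hc with h | h | h | h | ⟨v', -, h⟩ | ⟨u', -, h | h⟩ <;> grind

theorem four_mul_card_failing_le (hs : s.IsValid N H)
    (hserves : ∀ w x, x ∈ s.serves w → ∃ z, s.mid x z = some w) (hH : IsDense H (range N))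
    (hL : ∀ u v, #(tries u v) ≤ L) (hfew : ∀ x < N, 8 * (#(s.uncoloured N H x) * L) ≤ N)
    (hu : u < N) (hv : v < N) : 4 * #(s.failing N H tries u v) ≤ 3 * N := by
  have heighth : ∀ x < N, 8 * #(nonNbrs H (range N) x) ≤ N ∧ 8 * #(s.servers N x) ≤ N ∧
      8 * #(s.triedAt N H tries x) ≤ N := fun x hx => by
    have hx' := hH x (mem_range.2 hx)
    rw [card_range] at hx'
    exact ⟨hx', (Nat.mul_le_mul_left 8 (card_servers_le hs hserves)).trans hx',
      (Nat.mul_le_mul_left 8 (card_triedAt_le hs hL)).trans (hfew x hx)⟩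
  have hu' := heighth u hu
  have hv' := heighth v hv
  have := (card_le_card (failing_subset (N := N) (H := H) (s := s) (tries := tries)
    (u := u) (v := v))).trans <| (card_union_le _ _).trans <| Nat.add_le_add
      ((card_union_le _ _).trans (Nat.add_le_add (card_union_le _ _) (card_union_le _ _)))
      (card_union_le _ _)
  omega

end Step

section After

variable {tries tries' : ℕ → ℕ → ℕ → Finset ℕ} {t t' : ℕ}

theorem after_congr (h : ∀ t' < t, ∀ u v, u < v → v < N → tries t' u v = tries' t' u v) :
    after N H tries t = after N H tries' t := by
  induction t with
  | zero => rfl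
  | succ t ih =>
    rw [after, after, ih fun t' ht' => h t' (ht'.trans t.lt_succ_self)]
    exact step_congr (h t t.lt_succ_self)

theorem isValid_after : (after N H tries t).IsValid N H := by
  induction t with
  | zero => constructor <;> simp [after]
  | succ t ih => exact ih.step

theorem after_mid_eq_none_of_le (ht : t ≤ t') (h : (after N H tries t').mid u v = none) :
    (after N H tries t).mid u v = none := by
  induction t', ht using Nat.le_induction with
  | base => exact h
  | succ t' _ ih => exact ih (step_mid_eq_none_iff.1 h).1

-- With several trials per non-edge, two nodes could accept it, of which only one is used.
theorem exists_mid_eq_some_of_mem_serves (hone : ∀ t' < t, ∀ u v, #(tries t' u v) ≤ 1)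
    (h : x ∈ (after N H tries t).serves w) : ∃ z, (after N H tries t).mid x z = some w := by
  induction t with
  | zero => simp [after] at h
  | succ t ih =>
    rcases h with h | ⟨z, h⟩
    · obtain ⟨z, hz⟩ := ih (fun t' ht' => hone t' (ht'.trans t.lt_succ_self)) h
      exact ⟨z, by simp [after, step, hz]⟩
    · have hs : (after N H tries t).IsValid N H := isValid_after
      obtain ⟨-, -, -, hmid, hw⟩ := hs.of_connectsAt h
      have hunique : ∀ c, (after N H tries t).ConnectsAt N H (tries t) c x z → w = c := fun c hc =>
        card_le_one.1 (hone t t.lt_succ_self _ _) _ hw _ (hs.of_connectsAt hc).2.2.2.2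
      refine ⟨z, ?_⟩
      simp only [after, step, hmid, Option.none_or, least_eq_some_iff]
      exact ⟨h, fun c hc => (hunique c hc).le⟩

end After

end PartialOverlay

/-- The `index`-th middle node tried for the non-edge `{fst, snd}`, `fst < snd`, in phase
`phase`. -/
structure Trial where
  phase : ℕ
  fst : ℕ
  snd : ℕ
  index : ℕ

/-- The position of a trial in the order in which trials depend on each other. -/
def Trial.time (p : Trial) : ℕ ×ₗ ℕ ×ₗ ℕ := toLex (p.phase, toLex (p.fst, p.snd))

/-- The number of trials for each non-edge in phase `t`: one in each of the first `T` phases, and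
`l` in phase `T`, which is the last one. -/
def schedule (T l t : ℕ) : ℕ := if t < T then 1 else l

/-- The trials that may take place. -/
def trials (N T l : ℕ) : Set Trial :=
  {p | p.phase ≤ T ∧ p.fst < p.snd ∧ p.snd < N ∧ p.index < schedule T l p.phase}

section RandomTrials

variable {ι α : Type*} (N : ℕ) (H : SimpleGraph ℕ) (T l : ℕ) (col : α → ℕ) (κ : Trial → ι)
  (ω : ι → α)

/-- The middle nodes tried for `{u, v}` in phase `t`, where trial `p` reads its middle node off
the coordinate `κ p` of `ω`. -/
def drawn (t u v : ℕ) : Finset ℕ :=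
  (range (schedule T l t)).image fun j => col (ω (κ ⟨t, u, v, j⟩))

/-- The partial overlay after `t` phases of random trials. -/
noncomputable def randomOverlay (t : ℕ) : PartialOverlay :=
  PartialOverlay.after N H (drawn T l col κ ω) t

/-- The middle nodes that may fail in trial `p`. -/
noncomputable def failingAt (p : Trial) : Finset ℕ :=
  (randomOverlay N H T l col κ ω p.phase).failing N H (drawn T l col κ ω p.phase) p.fst p.snd

variable {N H T l col κ ω} {p q : Trial} {x z : ℕ}

theorem isValid_randomOverlay (t : ℕ) : (randomOverlay N H T l col κ ω t).IsValid N H :=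
  PartialOverlay.isValid_after

theorem card_drawn_le (t u v : ℕ) : #(drawn T l col κ ω t u v) ≤ schedule T l t :=
  card_image_le.trans (card_range _).le

theorem drawn_update [DecidableEq ι] (hκ : Set.InjOn κ (trials N T l)) (hq : q ∈ trials N T l)
    {t u v : ℕ} (ht : t ≤ T) (huv : u < v) (hv : v < N)
    (hne : toLex (t, toLex (u, v)) ≠ q.time) (a : α) :
    drawn T l col κ (Function.update ω (κ q) a) t u v = drawn T l col κ ω t u v := by
  refine image_congr fun j hj => ?_
  have hκne : κ ⟨t, u, v, j⟩ ≠ κ q := fun h =>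
    hne (congrArg Trial.time (hκ ⟨ht, huv, hv, mem_range.1 hj⟩ hq h))
  simp only [Function.update_of_ne hκne]

theorem failingAt_update [DecidableEq ι] (hκ : Set.InjOn κ (trials N T l))
    (hp : p ∈ trials N T l) (hq : q ∈ trials N T l) (hpq : p.time ≤ q.time) (a : α) :
    failingAt N H T l col κ (Function.update ω (κ q) a) p = failingAt N H T l col κ ω p := by
  have hearlier : ∀ {t u v}, u < v → v < N → toLex (t, toLex (u, v)) < p.time →
      drawn T l col κ (Function.update ω (κ q) a) t u v = drawn T l col κ ω t u v := by
    intro t u v huv hv hlt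
    refine drawn_update hκ hq ?_ huv hv (hlt.trans_le hpq).ne a
    rcases Prod.Lex.toLex_lt_toLex.1 hlt with h | h
    · exact h.le.trans hp.1
    · exact h.1.trans_le hp.1
  have hoverlay : randomOverlay N H T l col κ (Function.update ω (κ q) a) p.phase =
      randomOverlay N H T l col κ ω p.phase :=
    PartialOverlay.after_congr fun t ht u v huv hv =>
      hearlier huv hv (Prod.Lex.toLex_lt_toLex.2 (Or.inl ht))
  rw [failingAt, failingAt, hoverlay]
  refine PartialOverlay.failing_congr fun u v huv hv hlt => hearlier huv hv ?_
  exact Prod.Lex.toLex_lt_toLex.2 (Or.inr ⟨rfl, Prod.Lex.toLex_lt_toLex.2 hlt⟩)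

theorem col_mem_failingAt (hcol : ∀ a, col a < N) (hp : p ∈ trials N T l)
    (hne : IsNonEdge H (range N) p.fst p.snd)
    (h : (randomOverlay N H T l col κ ω (p.phase + 1)).mid p.fst p.snd = none) :
    col (ω (κ p)) ∈ failingAt N H T l col κ ω p :=
  PartialOverlay.mem_failing_of_step_mid_eq_none hp.2.1 hne
    (mem_image_of_mem _ (mem_range.2 hp.2.2.2)) (hcol _) h

theorem four_mul_card_failingAt_le (hH : IsDense H (range N)) (hp : p ∈ trials N T l)
    (hfew : ∀ x < N, 8 * (#((randomOverlay N H T l col κ ω p.phase).uncoloured N H x) *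
      schedule T l p.phase) ≤ N) :
    4 * #(failingAt N H T l col κ ω p) ≤ 3 * N := by
  have hone : ∀ t < p.phase, ∀ u v, #(drawn T l col κ ω t u v) ≤ 1 := fun t ht u v =>
    (card_drawn_le t u v).trans (if_pos (ht.trans_le hp.1)).le
  exact PartialOverlay.four_mul_card_failing_le (isValid_randomOverlay _)
    (fun w x h => PartialOverlay.exists_mid_eq_some_of_mem_serves hone h) hH
    (card_drawn_le p.phase) hfew (hp.2.1.trans hp.2.2.1) hp.2.2.1

theorem IsDense.eight_mul_card_uncoloured_le (hH : IsDense H (range N)) (s : PartialOverlay)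
    (hx : x < N) : 8 * #(s.uncoloured N H x) ≤ N := by
  have hsub : s.uncoloured N H x ⊆ nonNbrs H (range N) x := fun z hz => by
    obtain ⟨⟨-, hz, -, hxz⟩, -⟩ := PartialOverlay.mem_uncoloured.1 hz
    exact mem_nonNbrs.2 ⟨hz, hxz⟩
  calc 8 * #(s.uncoloured N H x) ≤ 8 * #(nonNbrs H (range N) x) := by gcongr
    _ ≤ #(range N) := hH x (mem_range.2 hx)
    _ = N := card_range N

variable [Finite ι] [Finite α] [Nonempty α]

theorem unifProb_trials_fail_le (hcol : IsUniformBelow N col) (hκ : Set.InjOn κ (trials N T l))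
    {S : Finset Trial} (hS : ∀ p ∈ S, p ∈ trials N T l) {E : Set (ι → α)}
    (hE : ∀ ω ∈ E, ∀ p ∈ S, 4 * #(failingAt N H T l col κ ω p) ≤ 3 * N ∧
      col (ω (κ p)) ∈ failingAt N H T l col κ ω p) :
    unifProb E ≤ (3 / 4) ^ #S := by
  classical
  let bad (p : Trial) (ω : ι → α) : Set α :=
    {a | 4 * #(failingAt N H T l col κ ω p) ≤ 3 * N ∧ col a ∈ failingAt N H T l col κ ω p}
  have hN : (0 : ℝ) < N := by
    obtain ⟨a⟩ := ‹Nonempty α›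
    exact_mod_cast (Nat.zero_le _).trans_lt (hcol.1 a)
  have hbad : ∀ p ω, unifProb (bad p ω) ≤ 3 / 4 := by
    intro p ω
    by_cases hcard : 4 * #(failingAt N H T l col κ ω p) ≤ 3 * N
    · have hle := hcol.2 (failingAt N H T l col κ ω p)
      have hcard' : (4 : ℝ) * #(failingAt N H T l col κ ω p) ≤ 3 * N := by exact_mod_cast hcard
      simp only [bad, hcard, true_and]
      rw [← mul_le_mul_iff_left₀ hN]
      linarith
    · simp only [bad, hcard, false_and, Set.ofPred_false, unifProb_empty]
      norm_num
  calc unifProb E ≤ unifProb {ω : ι → α | ∀ p ∈ S, ω (κ p) ∈ bad p ω} := unifProb_mono hE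
    _ ≤ (3 / 4) ^ #S := by
        refine unifProb_forall_coord_mem_le Trial.time (by norm_num) (hκ.mono hS) ?_
          fun p _ => hbad p
        intro p hp q hq hpq ω a
        simp only [bad, failingAt_update hκ (hS p hp) (hS q hq) hpq]

theorem unifProb_subset_uncoloured_le (hcol : IsUniformBelow N col)
    (hκ : Set.InjOn κ (trials N T l)) (hH : IsDense H (range N)) {S : Finset ℕ}
    (hS : ∀ z ∈ S, IsNonEdge H (range N) x z) :
    unifProb {ω : ι → α | S ⊆ (randomOverlay N H T l col κ ω T).uncoloured N H x} ≤
      (3 / 4) ^ (T * #S) := by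
  classical
  let trial (p : ℕ × ℕ) : Trial := ⟨p.1, min x p.2, max x p.2, 0⟩
  have htrial : Function.Injective trial := by
    rintro ⟨t, z⟩ ⟨t', z'⟩ h
    simp only [trial, Trial.mk.injEq, Prod.mk.injEq] at h ⊢
    omega
  rw [← card_range T, ← card_product, ← card_image_of_injective _ htrial, card_range]
  have hmem : ∀ p ∈ (range T ×ˢ S).image trial, p ∈ trials N T l := by
    simp only [forall_mem_image, mem_product, mem_range]
    rintro ⟨t, z⟩ ⟨ht, hz⟩
    obtain ⟨hx, hzN, hxz, -⟩ := hS z hz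
    simp only [mem_range] at hx hzN
    exact ⟨ht.le, min_lt_max.2 hxz, max_lt hx hzN, by simp [trial, schedule, ht]⟩
  refine unifProb_trials_fail_le (H := H) hcol hκ hmem fun ω hω p hp => ?_
  obtain ⟨⟨t, z⟩, htz, rfl⟩ := mem_image.1 hp
  obtain ⟨ht, hz⟩ := mem_product.1 htz
  have hone : schedule T l t = 1 := if_pos (mem_range.1 ht)
  have hmid : (randomOverlay N H T l col κ ω (t + 1)).mid x z = none :=
    PartialOverlay.after_mid_eq_none_of_le (mem_range.1 ht)
      (PartialOverlay.mem_uncoloured.1 (hω hz)).2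
  have hsorted : IsNonEdge H (range N) (min x z) (max x z) ∧
      (randomOverlay N H T l col κ ω (t + 1)).mid (min x z) (max x z) = none := by
    rcases le_total x z with h | h
    · rw [min_eq_left h, max_eq_right h]
      exact ⟨hS z hz, hmid⟩
    · rw [min_eq_right h, max_eq_left h, isNonEdge_comm, (isValid_randomOverlay _).mid_comm]
      exact ⟨hS z hz, hmid⟩
  refine ⟨four_mul_card_failingAt_le hH (hmem _ hp) fun x hx => ?_,
    col_mem_failingAt hcol.1 (hmem _ hp) hsorted.1 hsorted.2⟩
  simpa only [trial, hone, mul_one] using hH.eight_mul_card_uncoloured_le _ hx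

theorem unifProb_exists_le_card_uncoloured_le (hcol : IsUniformBelow N col)
    (hκ : Set.InjOn κ (trials N T l)) (hH : IsDense H (range N)) (r : ℕ) :
    unifProb {ω : ι → α | ∃ x < N, r ≤ #((randomOverlay N H T l col κ ω T).uncoloured N H x)} ≤
      N * ((N / 8).choose r * (3 / 4) ^ (T * r)) := by
  let others (x : ℕ) : Finset ℕ := (nonNbrs H (range N) x).erase x
  have hothers : ∀ x < N, ∀ z, z ∈ others x ↔ IsNonEdge H (range N) x z := fun x hx z => by
    simp only [others, mem_erase, mem_nonNbrs, IsNonEdge, mem_range, hx, true_and, ne_comm]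
    tauto
  have hcard : ∀ x < N, #(others x) ≤ N / 8 := fun x hx => by
    have := hH x (mem_range.2 hx)
    rw [card_range] at this
    exact (card_le_card (erase_subset _ _)).trans (by omega)
  calc unifProb {ω : ι → α | ∃ x < N, r ≤ #((randomOverlay N H T l col κ ω T).uncoloured N H x)}
      ≤ unifProb (⋃ x ∈ range N, ⋃ S ∈ powersetCard r (others x),
          {ω : ι → α | S ⊆ (randomOverlay N H T l col κ ω T).uncoloured N H x}) := by
        refine unifProb_mono ?_
        rintro ω ⟨x, hx, hr⟩
        obtain ⟨S, hS, rfl⟩ := exists_subset_card_eq hr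
        simp only [Set.mem_iUnion]
        exact ⟨x, mem_range.2 hx, S, mem_powersetCard.2 ⟨fun z hz =>
          (hothers x hx z).2 (PartialOverlay.mem_uncoloured.1 (hS hz)).1, rfl⟩, hS⟩
    _ ≤ ∑ x ∈ range N, ∑ _S ∈ powersetCard r (others x), (3 / 4 : ℝ) ^ (T * r) := by
        refine (unifProb_biUnion_le _ _).trans (sum_le_sum fun x hx => ?_)
        refine (unifProb_biUnion_le _ _).trans (sum_le_sum fun S hS => ?_)
        obtain ⟨hSsub, rfl⟩ := mem_powersetCard.1 hS
        exact unifProb_subset_uncoloured_le hcol hκ hH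
          fun z hz => (hothers x (mem_range.1 hx) z).1 (hSsub hz)
    _ ≤ ∑ x ∈ range N, ((N / 8).choose r * (3 / 4) ^ (T * r) : ℝ) := by
        refine sum_le_sum fun x hx => ?_
        rw [sum_const, card_powersetCard, nsmul_eq_mul]
        gcongr
        exact hcard x (mem_range.1 hx)
    _ = N * ((N / 8).choose r * (3 / 4) ^ (T * r)) := by rw [sum_const, card_range, nsmul_eq_mul]

theorem unifProb_last_phase_fail_le (hcol : IsUniformBelow N col)
    (hκ : Set.InjOn κ (trials N T l)) (hH : IsDense H (range N)) :
    unifProb {ω : ι → α |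
      (∀ x < N, 8 * (#((randomOverlay N H T l col κ ω T).uncoloured N H x) * l) ≤ N) ∧
      ∃ u v, u < v ∧ IsNonEdge H (range N) u v ∧
        (randomOverlay N H T l col κ ω (T + 1)).mid u v = none} ≤ N ^ 2 * (3 / 4) ^ l := by
  classical
  let fails (u v : ℕ) : Set (ι → α) := {ω |
    (∀ x < N, 8 * (#((randomOverlay N H T l col κ ω T).uncoloured N H x) * l) ≤ N) ∧
    u < v ∧ IsNonEdge H (range N) u v ∧ (randomOverlay N H T l col κ ω (T + 1)).mid u v = none}
  have hlast : schedule T l T = l := if_neg (lt_irrefl T)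
  have hfails : ∀ u v, unifProb (fails u v) ≤ (3 / 4) ^ l := by
    intro u v
    by_cases huv : u < v ∧ v < N
    · let trial (j : ℕ) : Trial := ⟨T, u, v, j⟩
      have htrial : Function.Injective trial := fun i j h => (Trial.mk.injEq .. ▸ h).2.2.2
      rw [← card_range l, ← card_image_of_injective _ htrial]
      have hmem : ∀ p ∈ (range l).image trial, p ∈ trials N T l := by
        simp only [forall_mem_image, mem_range]
        exact fun j hj => ⟨le_rfl, huv.1, huv.2, hlast.symm ▸ hj⟩
      refine unifProb_trials_fail_le (H := H) hcol hκ hmem ?_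
      rintro ω ⟨hfew, -, hne, hmid⟩ p hp
      obtain ⟨j, -, rfl⟩ := mem_image.1 hp
      exact ⟨four_mul_card_failingAt_le hH (hmem _ hp) (by simpa only [trial, hlast] using hfew),
        col_mem_failingAt hcol.1 (hmem _ hp) hne hmid⟩
    · have hempty : fails u v = ∅ := Set.eq_empty_of_forall_notMem
        fun ω ⟨_, hlt, hne, _⟩ => huv ⟨hlt, mem_range.1 hne.2.1⟩
      rw [hempty, unifProb_empty]
      positivity
  calc _ ≤ unifProb (⋃ p ∈ range N ×ˢ range N, fails p.1 p.2) := by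
        refine unifProb_mono ?_
        rintro ω ⟨hfew, u, v, huv, hne, hmid⟩
        simp only [Set.mem_iUnion]
        exact ⟨(u, v), mem_product.2 ⟨hne.1, hne.2.1⟩, hfew, huv, hne, hmid⟩
    _ ≤ ∑ p ∈ range N ×ˢ range N, unifProb (fails p.1 p.2) := unifProb_biUnion_le _ _
    _ ≤ #(range N ×ˢ range N) • (3 / 4) ^ l := sum_le_card_nsmul _ _ _ fun p _ => hfails _ _
    _ = N ^ 2 * (3 / 4) ^ l := by
        rw [card_product, card_range, nsmul_eq_mul, Nat.cast_mul, sq]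

theorem unifProb_exists_mid_eq_none_le (hcol : IsUniformBelow N col)
    (hκ : Set.InjOn κ (trials N T l)) (hH : IsDense H (range N)) {r : ℕ}
    (hr : ∀ m < r, 8 * (m * l) ≤ N) :
    unifProb {ω : ι → α | ∃ u v, IsNonEdge H (range N) u v ∧
        (randomOverlay N H T l col κ ω (T + 1)).mid u v = none} ≤
      N * ((N / 8).choose r * (3 / 4) ^ (T * r)) + N ^ 2 * (3 / 4) ^ l := by
  refine (unifProb_mono ?_).trans <| (unifProb_union_le _ _).trans <|
    add_le_add (unifProb_exists_le_card_uncoloured_le hcol hκ hH r)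
      (unifProb_last_phase_fail_le hcol hκ hH)
  rintro ω ⟨u, v, hne, hmid⟩
  by_cases hmany : ∃ x < N, r ≤ #((randomOverlay N H T l col κ ω T).uncoloured N H x)
  · exact Or.inl hmany
  · push Not at hmany
    refine Or.inr ⟨fun x hx => hr _ (hmany x hx), ?_⟩
    rcases hne.2.2.1.lt_or_gt with h | h
    · exact ⟨u, v, h, hne, hmid⟩
    · exact ⟨v, u, h, isNonEdge_comm.1 hne, (isValid_randomOverlay _).mid_comm u v ▸ hmid⟩

end RandomTrials

/-- The code of a node of a network with a round counter and with natural numbers as messages: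
`send t s i` is the message to the neighbour with ID `i` in round `t`, and `recv t s m` is the
state after the messages `m i` from the neighbours with ID `i`. -/
structure Code (In Out : Type) where
  Seed : Type
  [seedFintype : Fintype Seed]
  [seedNonempty : Nonempty Seed]
  State : Type
  init : ℕ → Finset ℕ → In → Seed → State
  send : ℕ → State → ℕ → ℕ
  recv : ℕ → State → (ℕ → ℕ) → State
  output : State → Out

attribute [instance] Code.seedFintype Code.seedNonempty

namespace Code

variable {In Out V : Type} (c : Code In Out) (bits : ℕ) (G : SimpleGraph V) (id : V ↪ ℕ)

/-- The algorithm that sends the messages of `c` modulo `2 ^ bits` in binary. -/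
noncomputable abbrev toCongest (rounds : ℕ) : CongestAlgorithm In Out where
  Seed := c.Seed
  State := ℕ × c.State
  msgBits := bits
  rounds := rounds
  init i nbrs inp seed := (0, c.init i nbrs inp seed)
  send s i := fun k => (c.send s.1 s.2 i).testBit k
  recv s M := (s.1 + 1, c.recv s.1 s.2 fun i => sInf {x | ∃ m, (i, m) ∈ M ∧ Nat.ofBits m = x})
  output s := c.output s.2

/-- The messages that arrive at `v` in round `t` if the nodes are in the states `S`. The message
from an ID that does not belong to a neighbour is `sInf ∅ = 0`. -/
noncomputable def inbox (t : ℕ) (S : V → c.State) (v : V) (i : ℕ) : ℕ :=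
  sInf {x | ∃ u, G.Adj v u ∧ id u = i ∧ c.send t (S u) (id v) % 2 ^ bits = x}

theorem inbox_eq {t : ℕ} {S : V → c.State} {u v : V} (h : G.Adj v u) :
    c.inbox bits G id t S v (id u) = c.send t (S u) (id v) % 2 ^ bits := by
  have hsingleton : {x | ∃ u', G.Adj v u' ∧ id u' = id u ∧ c.send t (S u') (id v) % 2 ^ bits = x} =
      {c.send t (S u) (id v) % 2 ^ bits} := by
    ext x
    simp only [EmbeddingLike.apply_eq_iff_eq, Set.mem_ofPred_eq, Set.mem_singleton_iff]
    exact ⟨fun ⟨_, _, e, hx⟩ => e ▸ hx.symm, fun hx => ⟨u, h, rfl, hx.symm⟩⟩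
  rw [inbox, hsingleton, csInf_singleton]

variable [Fintype V] [DecidableRel G.Adj] (input : V → In) (ω : V → c.Seed)

/-- The states of the nodes after `t` rounds of communication. -/
noncomputable def exec : ℕ → V → c.State
  | 0, v => c.init (id v) ((G.neighborFinset v).map id) (input v) (ω v)
  | t + 1, v => c.recv t (exec t v) (c.inbox bits G id t (exec t) v)

theorem stateAt_toCongest (rounds t : ℕ) (v : V) :
    (c.toCongest bits rounds).stateAt G id input ω t v = (t, c.exec bits G id input ω t v) := by
  induction t generalizing v with
  | zero => rfl
  | succ t ih =>
    rw [CongestAlgorithm.stateAt.eq_def, exec]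
    simp only [ih, mem_image, SimpleGraph.mem_neighborFinset, Prod.mk.injEq, true_and]
    congr 1
    funext i
    refine congrArg sInf (Set.ext fun x => ?_)
    constructor
    · rintro ⟨_, ⟨u, hu, hi, rfl⟩, hx⟩
      exact ⟨u, hu, hi, Nat.ofBits_testBit .. ▸ hx⟩
    · rintro ⟨u, hu, hi, hx⟩
      exact ⟨_, ⟨u, hu, hi, rfl⟩, (Nat.ofBits_testBit ..).trans hx⟩

theorem run_toCongest (rounds : ℕ) (v : V) :
    (c.toCongest bits rounds).run G id input ω v = c.output (c.exec bits G id input ω rounds v) :=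
  congrArg (fun s : ℕ × c.State => c.output s.2)
    (c.stateAt_toCongest bits G id input ω rounds rounds v)

end Code

/-- The parameters of the overlay algorithm for clusters of at most `maxSize` nodes: `phases`
phases with a single trial, a last phase with `lastTrials` trials, and a bound `maxValue` on the
numbers that a message may consist of. -/
structure Params where
  maxSize : ℕ
  phases : ℕ
  lastTrials : ℕ
  maxValue : ℕ

namespace Params

variable (P : Params)

/-- The indices of the random numbers of a node: phase, label of the other end, trial. -/
abbrev Index : Type := Fin (P.phases + 1) × Fin (P.maxSize + 1) × Fin (P.lastTrials + 1)

/-- The random numbers of a node. A uniform number below `maxSize!` is uniform modulo the size of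
every cluster. -/
abbrev Seed : Type := P.Index → Fin P.maxSize.factorial

instance : Nonempty P.Seed := ⟨fun _ => ⟨0, P.maxSize.factorial_pos⟩⟩

/-- The index of the random number for trial `j` of phase `t` and the other end with label `v`. -/
def index (t v j : ℕ) : P.Index := (Fin.ofNat _ t, Fin.ofNat _ v, Fin.ofNat _ j)

/-- Enough bits for a pair of numbers up to `maxValue`. -/
def bits : ℕ := 2 * P.maxValue.size

/-- Seven rounds for the labels, and two for every phase. -/
def rounds : ℕ := 2 * (P.phases + 1) + 7

end Params

/-- The memory of a node: the IDs of its neighbours, its input, its random numbers, the messages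
`mail t i` received so far, its part of the partial overlay, in terms of labels. -/
structure Node where
  nbrs : Finset ℕ
  ac : ℕ
  isLeader : ℕ
  seed : ℕ → ℕ → ℕ → ℕ
  mail : ℕ → ℕ → ℕ
  serves : Set ℕ
  mid : ℕ → Option ℕ

namespace Node

variable (P : Params) (s : Node) (p : ℕ)

/-- The IDs of the neighbours in the cluster of the node. -/
def members : Finset ℕ := {i ∈ s.nbrs | (s.mail 0 i).unpair.1 = s.ac}

/-- The set of the ID of the leader, empty for a node that is not adjacent to the leader. -/
def leaders : Finset ℕ := {i ∈ s.members | (s.mail 0 i).unpair.2 = 1}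

/-- The ID of the leader, for a node that is adjacent to the leader. -/
noncomputable def leader : ℕ := sInf {i | i ∈ s.leaders}

/-- The ID of the neighbour that relays the messages between the node and the leader. -/
noncomputable def relay : ℕ := sInf {i | i ∈ s.members ∧ s.mail 1 i = 1}

/-- The IDs of the nodes for which the node is the relay. -/
def clients : Finset ℕ := {i ∈ s.members | s.mail 2 i = 1}

/-- The label of the node, as learnt from its relay. -/
noncomputable def label : ℕ := (s.mail 5 s.relay).unpair.1

/-- The number of nodes of the cluster, as learnt from the relay. -/
noncomputable def size : ℕ := (s.mail 5 s.relay).unpair.2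

/-- The label of the neighbour with ID `i`. -/
def labelOf (i : ℕ) : ℕ := s.mail 6 i

/-- The labels of the neighbours in the cluster. -/
def nbrLabels : Set ℕ := {c | ∃ i ∈ s.members, s.labelOf i = c}

/-- The middle nodes tried in phase `p`. -/
noncomputable def tries (v : ℕ) : Finset ℕ :=
  (range (schedule P.phases P.lastTrials p)).image fun j => s.seed p v j % s.size

/-- The message to the neighbour with ID `i` in the first round of phase `p`: the label, plus one,
of the node to which a connection is requested, or `0`. -/
noncomputable def request (i : ℕ) : ℕ :=
  (least (wishes s.size s.label s.nbrLabels s.mid (s.tries P p) (s.labelOf i))).elim 0 (· + 1)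

/-- The node connects the nodes with the labels `u` and `v` in phase `p`. -/
def connects (u v : ℕ) : Prop :=
  Connects s.nbrLabels s.serves
    (fun u v => ∃ i ∈ s.members, s.labelOf i = u ∧ s.mail (2 * p + 7) i = v + 1) u v

/-- The message to the neighbour with ID `i` in the second round of phase `p`: the label, plus one,
and the ID of the node to which it gets connected, or `0`. -/
noncomputable def answer (i : ℕ) : ℕ :=
  (least {j | j ∈ s.members ∧ s.connects p (s.labelOf i) (s.labelOf j)}).elim 0
    fun j => Nat.pair (s.labelOf j + 1) j

/-- The messages of a node. The leader, to which each relay reports the number of its clients in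
round 3, reserves in round 4 consecutive labels for the clients of each relay, which the relay
distributes in round 5. -/
noncomputable def send : ℕ → Node → ℕ → ℕ
  | 0, s, _ => Nat.pair s.ac s.isLeader
  | 1, s, _ => #s.leaders
  | 2, s, i => if i = s.relay then 1 else 0
  | 3, s, _ => #s.clients
  | 4, s, i => Nat.pair (∑ j ∈ s.members with j < i, s.mail 3 j) (∑ j ∈ s.members, s.mail 3 j)
  | 5, s, i => Nat.pair ((s.mail 4 s.leader).unpair.1 + #{j ∈ s.clients | j < i})
      (s.mail 4 s.leader).unpair.2
  | 6, s, _ => s.label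
  | t + 7, s, i => if t % 2 = 0 then s.request P (t / 2) i else s.answer (t / 2) i

/-- The memory of a node at the end of phase `p`. -/
noncomputable def endPhase : Node :=
  { s with
    serves := s.serves ∪ {x | ∃ z, s.connects p x z}
    mid := fun y => (s.mid y).or (least {c | ∃ i ∈ s.members, s.labelOf i = c ∧
      (s.mail (2 * p + 8) i).unpair.1 = y + 1}) }

/-- The node has learnt that the node with label `y` has the ID `i`. -/
def Knows (y i : ℕ) : Prop := ∃ p, ∃ j ∈ s.members, s.mail (2 * p + 8) j = Nat.pair (y + 1) i

/-- The ID of the middle node of the path to the node with ID `i`, if there is one. -/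
noncomputable def output (i : ℕ) : Option ℕ :=
  least {j | j ∈ s.members ∧ ∃ y, s.Knows y i ∧ s.mid y = some (s.labelOf j)}

/-- The memory of a node after the messages `m` of round `t`. -/
noncomputable def recv (t : ℕ) (m : ℕ → ℕ) : Node :=
  let received := { s with mail := Function.update s.mail t m }
  if t < 7 ∨ t % 2 = 1 then received else received.endPhase ((t - 8) / 2)

end Node

/-- The overlay algorithm. AC-IDs are shifted by one, and `0` stands for a node in no cluster. -/
noncomputable def overlayCode (P : Params) : Code CliqueInput (ℕ → Option ℕ) where
  Seed := P.Seed
  State := Node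
  init _ nbrs inp seed :=
    { nbrs := nbrs
      ac := inp.acId.elim 0 (· + 1)
      isLeader := inp.isLeader.toNat
      seed := fun t v j => seed (P.index t v j)
      mail := 0
      serves := ∅
      mid := fun _ => none }
  send := Node.send P
  recv t s := s.recv t
  output := Node.output

section Labels

variable {V : Type} (G : SimpleGraph V) (id : V ↪ ℕ) (C : Finset V) (w x : V)

/-- The least ID of a neighbour of `x` in `C` that is adjacent to the leader `w`. -/
noncomputable def relayId : ℕ := sInf {i | ∃ z ∈ C, G.Adj x z ∧ G.Adj z w ∧ id z = i}

/-- The key by which the nodes of `C` are ordered: by relay first, so that the clients of a relay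
get consecutive labels. -/
noncomputable def labelKey : ℕ ×ₗ ℕ := toLex (relayId G id C w x, id x)

/-- The rank of `x` among the nodes of `C`, which are ordered by their keys. -/
noncomputable def label : ℕ := #{z ∈ C | labelKey G id C w z < labelKey G id C w x}

/-- The inverse of `label`. -/
noncomputable def nodeWithLabel (c : ℕ) : V :=
  haveI : Nonempty V := ⟨w⟩
  Function.invFunOn (label G id C w) C c

variable {G id C w x}

theorem IsDense.exists_relay (hC : IsDense G C) (hw : w ∈ C) (hx : x ∈ C) :
    ∃ z ∈ C, G.Adj x z ∧ G.Adj z w ∧ id z = relayId G id C w x := by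
  obtain ⟨z, hz, hxz, hzw⟩ := hC.exists_common_neighbor hx hw
  exact Nat.sInf_mem (s := {i | ∃ z ∈ C, G.Adj x z ∧ G.Adj z w ∧ id z = i})
    ⟨id z, z, hz, hxz, hzw, rfl⟩

theorem labelKey_injective : Function.Injective (labelKey G id C w) := fun _ _ h =>
  id.injective (congrArg (fun p : ℕ ×ₗ ℕ => (ofLex p).2) h)

theorem label_lt_card (hx : x ∈ C) : label G id C w x < #C :=
  card_lt_card (filter_ssubset.2 ⟨x, hx, lt_irrefl _⟩)

theorem label_lt_label {x' : V} (hx : x ∈ C)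
    (h : labelKey G id C w x < labelKey G id C w x') : label G id C w x < label G id C w x' := by
  refine card_lt_card ⟨fun z hz => ?_, fun hsub => ?_⟩
  · obtain ⟨hzC, hz⟩ := mem_filter.1 hz
    exact mem_filter.2 ⟨hzC, hz.trans h⟩
  · exact lt_irrefl _ (mem_filter.1 (hsub (mem_filter.2 ⟨hx, h⟩))).2

theorem bijOn_label : Set.BijOn (label G id C w) C (range #C) := by
  have hinj : Set.InjOn (label G id C w) C := fun x hx y hy h => by
    by_contra hne
    have hkey : labelKey G id C w x ≠ labelKey G id C w y := labelKey_injective.ne hne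
    rcases hkey.lt_or_gt with h' | h'
    · exact (label_lt_label hx h').ne h
    · exact (label_lt_label hy h').ne' h
  have hmaps : Set.MapsTo (label G id C w) C (range #C) := fun x hx =>
    mem_coe.2 (mem_range.2 (label_lt_card hx))
  exact ⟨hmaps, hinj, surjOn_of_injOn_of_card_le _ hmaps hinj (card_range _).le⟩

theorem nodeWithLabel_label (hx : x ∈ C) :
    nodeWithLabel G id C w (label G id C w x) = x :=
  haveI : Nonempty V := ⟨w⟩
  bijOn_label.injOn.leftInvOn_invFunOn hx

theorem label_nodeWithLabel {c : ℕ} (hc : c < #C) :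
    label G id C w (nodeWithLabel G id C w c) = c :=
  haveI : Nonempty V := ⟨w⟩
  bijOn_label.surjOn.rightInvOn_invFunOn (mem_coe.2 (mem_range.2 hc))

theorem label_eq_add_card : label G id C w x =
    #{z ∈ C | relayId G id C w z < relayId G id C w x} +
      #{z ∈ C | relayId G id C w z = relayId G id C w x ∧ id z < id x} := by
  classical
  rw [label, ← card_union_of_disjoint]
  · congr 1
    ext z
    simp only [mem_union, mem_filter, labelKey, Prod.Lex.toLex_lt_toLex, and_or_left]
  · refine disjoint_left.2 fun z hz hz' => ?_
    exact (mem_filter.1 hz).2.ne (mem_filter.1 hz').2.1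

end Labels

section Relabelling

variable {V : Type} (G : SimpleGraph V) (C : Finset V) (lab : V → ℕ)

/-- The graph `G[C]` in terms of labels. -/
def labelGraph : SimpleGraph ℕ := (G.induce (C : Set V)).map fun x : (C : Set V) => lab x

variable {G C lab} {x u v : V}

theorem labelGraph_adj_iff (hlab : Set.BijOn lab C (range #C)) (hx : x ∈ C) {d : ℕ} :
    (labelGraph G C lab).Adj (lab x) d ↔ ∃ z ∈ C, G.Adj x z ∧ lab z = d := by
  rw [labelGraph, SimpleGraph.map_adj']
  constructor
  · rintro ⟨-, ⟨x', hx'⟩, ⟨z, hz⟩, hadj, hxx', rfl⟩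
    exact ⟨z, hz, hlab.injOn hx' hx hxx' ▸ hadj, rfl⟩
  · rintro ⟨z, hz, hadj, rfl⟩
    exact ⟨fun h => hadj.ne (hlab.injOn hx hz h), ⟨x, hx⟩, ⟨z, hz⟩, hadj, rfl, rfl⟩

theorem labelGraph_adj_label_iff (hlab : Set.BijOn lab C (range #C)) (hu : u ∈ C) (hv : v ∈ C) :
    (labelGraph G C lab).Adj (lab u) (lab v) ↔ G.Adj u v := by
  rw [labelGraph_adj_iff hlab hu]
  exact ⟨fun ⟨z, hz, hadj, h⟩ => hlab.injOn hz hv h ▸ hadj, fun h => ⟨v, hv, h, rfl⟩⟩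

theorem isNonEdge_labelGraph_iff (hlab : Set.BijOn lab C (range #C)) (hu : u ∈ C) (hv : v ∈ C) :
    IsNonEdge (labelGraph G C lab) (range #C) (lab u) (lab v) ↔ IsNonEdge G C u v := by
  simp only [IsNonEdge, labelGraph_adj_label_iff hlab hu hv, hu, hv,
    mem_coe.1 (hlab.mapsTo hu), mem_coe.1 (hlab.mapsTo hv), true_and, ne_eq,
    hlab.injOn.eq_iff hu hv]

theorem isDense_labelGraph (hlab : Set.BijOn lab C (range #C)) (hC : IsDense G C) :
    IsDense (labelGraph G C lab) (range #C) := by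
  classical
  intro c hc
  obtain ⟨x, hx, rfl⟩ := hlab.surjOn hc
  have hsub : nonNbrs (labelGraph G C lab) (range #C) (lab x) ⊆ (nonNbrs G C x).image lab := by
    intro d hd
    obtain ⟨hd, hadj⟩ := mem_nonNbrs.1 hd
    obtain ⟨z, hz, rfl⟩ := hlab.surjOn hd
    exact mem_image_of_mem _ (mem_nonNbrs.2 ⟨hz, fun h =>
      hadj ((labelGraph_adj_label_iff hlab hx hz).2 h)⟩)
  rw [card_range]
  have := (card_le_card hsub).trans card_image_le
  have := hC x hx
  omega

end Relabelling

namespace Params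

variable {P : Params} {p q : ℕ}

theorem pair_mod_two_pow_bits (hp : p ≤ P.maxValue) (hq : q ≤ P.maxValue) :
    Nat.pair p q % 2 ^ P.bits = Nat.pair p q := by
  refine Nat.mod_eq_of_lt ?_
  calc Nat.pair p q < (max p q + 1) ^ 2 := Nat.pair_lt_max_add_one_sq p q
    _ ≤ (2 ^ P.maxValue.size) ^ 2 := Nat.pow_le_pow_left
        (Nat.succ_le_of_lt ((max_le hp hq).trans_lt (Nat.lt_size_self _))) 2
    _ = 2 ^ P.bits := by rw [← pow_mul, mul_comm, bits]

theorem mod_two_pow_bits (hp : p ≤ P.maxValue) : p % 2 ^ P.bits = p :=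
  Nat.mod_eq_of_lt <| (hp.trans_lt (Nat.lt_size_self _)).trans_le <|
    Nat.pow_le_pow_right two_pos (Nat.le_mul_of_pos_left _ two_pos)

end Params

namespace Node

variable {P : Params} {s : Node} {p t i : ℕ} {m : ℕ → ℕ}

theorem send_request_round : send P (2 * p + 7) s i = s.request P p i := by
  simp [send]

theorem send_answer_round : send P (2 * p + 8) s i = s.answer p i := by
  rw [send, if_neg (by omega)]
  congr 1
  omega

theorem recv_of_lt (ht : t < 7) : s.recv t m = { s with mail := Function.update s.mail t m } :=
  if_pos (Or.inl ht)

theorem recv_request_round :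
    s.recv (2 * p + 7) m = { s with mail := Function.update s.mail (2 * p + 7) m } :=
  if_pos (Or.inr (by omega))

theorem recv_answer_round : s.recv (2 * p + 8) m =
    endPhase { s with mail := Function.update s.mail (2 * p + 8) m } p := by
  rw [recv, if_neg (by omega)]
  congr 1
  omega

theorem recv_answer_round_serves :
    (s.recv (2 * p + 8) m).serves = s.serves ∪ {x | ∃ z, s.connects p x z} := by
  simp [recv_answer_round, endPhase, connects, nbrLabels, labelOf, members]

theorem recv_answer_round_mid (y : ℕ) : (s.recv (2 * p + 8) m).mid y =
    (s.mid y).or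
      (least {c | ∃ i ∈ s.members, s.labelOf i = c ∧ (m i).unpair.1 = y + 1}) := by
  simp [recv_answer_round, endPhase, labelOf, members]

end Node

/-- The data that determine an execution of the overlay algorithm. -/
structure Execution (V : Type) where
  params : Params
  graph : SimpleGraph V
  [decidableAdj : DecidableRel graph.Adj]
  id : V ↪ ℕ
  input : V → CliqueInput
  seed : V → params.Seed

attribute [instance] Execution.decidableAdj

namespace Execution

section Memory

variable {V : Type} [Fintype V] (X : Execution V)

/-- The memory of node `v` after `t` rounds. -/
noncomputable def node (t : ℕ) (v : V) : Node :=
  (overlayCode X.params).exec X.params.bits X.graph X.id X.input X.seed t v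

/-- The messages that `v` receives in round `t`. -/
noncomputable def mail (t : ℕ) (v : V) : ℕ → ℕ :=
  (overlayCode X.params).inbox X.params.bits X.graph X.id t (X.node t) v

/-- `C` is a member of the family, with leader `w`, to which the parameters are adapted. -/
structure IsCluster (C : Finset V) (w : V) : Prop where
  isDense : IsDense X.graph C
  exists_acId : ∃ i, ∀ v, v ∈ C ↔ (X.input v).acId = some i
  leader_mem : w ∈ C
  isLeader_iff : ∀ v ∈ C, (X.input v).isLeader = true ↔ v = w
  card_le_maxSize : #C ≤ X.params.maxSize
  card_le_maxValue : #C ≤ X.params.maxValue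
  id_le : ∀ v, X.id v ≤ X.params.maxValue
  acId_lt : ∀ v i, (X.input v).acId = some i → i < X.params.maxValue

variable {X} {t r : ℕ} {u v : V}

theorem node_succ : X.node (t + 1) v = (X.node t v).recv t (X.mail t v) := rfl

theorem mail_eq (h : X.graph.Adj v u) :
    X.mail t v (X.id u) = Node.send X.params t (X.node t u) (X.id v) % 2 ^ X.params.bits :=
  Code.inbox_eq _ _ _ _ h

theorem node_static : (X.node t v).nbrs = (X.graph.neighborFinset v).map X.id ∧
    (X.node t v).ac = (X.input v).acId.elim 0 (· + 1) ∧
    (X.node t v).isLeader = (X.input v).isLeader.toNat ∧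
    (X.node t v).seed = fun p u j => (X.seed v (X.params.index p u j) : ℕ) := by
  induction t with
  | zero => exact ⟨rfl, rfl, rfl, rfl⟩
  | succ t ih =>
    rw [node_succ, Node.recv]
    split_ifs <;> exact ih

theorem node_mail : (X.node t v).mail r = if r < t then X.mail r v else 0 := by
  induction t with
  | zero => rfl
  | succ t ih =>
    have hupdate : (X.node (t + 1) v).mail = Function.update (X.node t v).mail t (X.mail t v) := by
      rw [node_succ, Node.recv]
      split_ifs <;> rfl
    rw [hupdate, Function.update_apply, ih]
    grind

end Memory

namespace IsCluster

variable {V : Type} {X : Execution V} {C : Finset V} {w : V}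

theorem one_le_maxValue (hC : X.IsCluster C w) : 1 ≤ X.params.maxValue :=
  (card_pos.2 ⟨w, hC.leader_mem⟩).trans_le hC.card_le_maxValue

theorem card_filter_le_maxValue (hC : X.IsCluster C w) (p : V → Prop) [DecidablePred p] :
    #{z ∈ C | p z} ≤ X.params.maxValue :=
  (card_filter_le _ _).trans hC.card_le_maxValue

variable [Fintype V]

section Labels

variable {t i : ℕ} {x z : V}

theorem mail_zero (hC : X.IsCluster C w) (h : X.graph.Adj x z) : X.mail 0 x (X.id z) =
    Nat.pair ((X.input z).acId.elim 0 (· + 1)) (X.input z).isLeader.toNat := by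
  rw [mail_eq h, Node.send, node_static.2.1, node_static.2.2.1]
  refine Params.pair_mod_two_pow_bits ?_ ((Bool.toNat_le _).trans hC.one_le_maxValue)
  cases hz : (X.input z).acId with
  | none => exact Nat.zero_le _
  | some i => exact hC.acId_lt z i hz

theorem mem_members (hC : X.IsCluster C w) (hx : x ∈ C) (ht : 0 < t) :
    i ∈ (X.node t x).members ↔ ∃ z ∈ C, X.graph.Adj x z ∧ X.id z = i := by
  obtain ⟨k, hk⟩ := hC.exists_acId
  have hsame : ∀ z, X.graph.Adj x z →
      (((X.mail 0 x (X.id z)).unpair.1 = (X.node t x).ac) ↔ z ∈ C) := by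
    intro z hxz
    rw [hC.mail_zero hxz, Nat.unpair_pair, node_static.2.1, (hk x).1 hx, hk z]
    cases (X.input z).acId <;> simp
  simp only [Node.members, mem_filter, node_static.1, mem_map, SimpleGraph.mem_neighborFinset,
    node_mail, ht, if_true]
  constructor
  · rintro ⟨⟨z, hxz, rfl⟩, h⟩
    exact ⟨z, (hsame z hxz).1 h, hxz, rfl⟩
  · rintro ⟨z, hz, hxz, rfl⟩
    exact ⟨⟨z, hxz, rfl⟩, (hsame z hxz).2 hz⟩

theorem mem_leaders (hC : X.IsCluster C w) (hx : x ∈ C) (ht : 0 < t) :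
    i ∈ (X.node t x).leaders ↔ X.graph.Adj x w ∧ i = X.id w := by
  have hleader : ∀ z ∈ C, X.graph.Adj x z → ((X.mail 0 x (X.id z)).unpair.2 = 1 ↔ z = w) := by
    intro z hz hxz
    rw [hC.mail_zero hxz, Nat.unpair_pair, Bool.toNat_eq_one, hC.isLeader_iff z hz]
  simp only [Node.leaders, mem_filter, hC.mem_members hx ht, node_mail, ht, if_true]
  constructor
  · rintro ⟨⟨z, hz, hxz, rfl⟩, h⟩
    obtain rfl := (hleader z hz hxz).1 h
    exact ⟨hxz, rfl⟩
  · rintro ⟨hxw, rfl⟩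
    exact ⟨⟨w, hC.leader_mem, hxw, rfl⟩, (hleader w hC.leader_mem hxw).2 rfl⟩

theorem leader_eq (hC : X.IsCluster C w) (hx : x ∈ C) (ht : 0 < t) (h : X.graph.Adj x w) :
    (X.node t x).leader = X.id w := by
  simp [Node.leader, hC.mem_leaders hx ht, h]

theorem mail_one_eq_one_iff (hC : X.IsCluster C w) (hz : z ∈ C) (h : X.graph.Adj x z) :
    X.mail 1 x (X.id z) = 1 ↔ X.graph.Adj z w := by
  have hleaders : (X.node 1 z).leaders = if X.graph.Adj z w then {X.id w} else ∅ := by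
    ext i
    rw [hC.mem_leaders hz one_pos]
    split_ifs with hzw <;> simp [hzw]
  rw [mail_eq h, Node.send, hleaders]
  split_ifs with hzw <;> simp [hzw, Params.mod_two_pow_bits hC.one_le_maxValue]

theorem relay_eq (hC : X.IsCluster C w) (hx : x ∈ C) (ht : 1 < t) :
    (X.node t x).relay = relayId X.graph X.id C w x := by
  refine congrArg sInf (Set.ext fun i => ?_)
  simp only [Set.mem_ofPred_eq, hC.mem_members hx (one_pos.trans ht), node_mail, ht, if_true]
  constructor
  · rintro ⟨⟨z, hz, hxz, rfl⟩, h⟩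
    exact ⟨z, hz, hxz, (hC.mail_one_eq_one_iff hz hxz).1 h, rfl⟩
  · rintro ⟨z, hz, hxz, hzw, rfl⟩
    exact ⟨⟨z, hz, hxz, rfl⟩, (hC.mail_one_eq_one_iff hz hxz).2 hzw⟩

theorem clients_eq (hC : X.IsCluster C w) (hx : x ∈ C) (ht : 2 < t) :
    (X.node t x).clients = {z ∈ C | relayId X.graph X.id C w z = X.id x}.map X.id := by
  have hclient : ∀ z ∈ C, X.graph.Adj x z →
      (X.mail 2 x (X.id z) = 1 ↔ relayId X.graph X.id C w z = X.id x) := by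
    intro z hz hxz
    rw [mail_eq hxz, Node.send, hC.relay_eq hz one_lt_two]
    split_ifs with h
    · simp [h, Params.mod_two_pow_bits hC.one_le_maxValue]
    · simp [Ne.symm h]
  ext i
  simp only [Node.clients, mem_filter, mem_map, hC.mem_members hx (two_pos.trans ht), node_mail,
    ht, if_true]
  constructor
  · rintro ⟨⟨z, hz, hxz, rfl⟩, h⟩
    exact ⟨z, ⟨hz, (hclient z hz hxz).1 h⟩, rfl⟩
  · rintro ⟨z, ⟨hz, h⟩, rfl⟩
    obtain ⟨y, -, hzy, -, hy⟩ := hC.isDense.exists_relay hC.leader_mem hz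
    obtain rfl := X.id.injective (hy.trans h)
    exact ⟨⟨z, hz, hzy.symm, rfl⟩, (hclient z hz hzy.symm).2 h⟩

theorem sum_mail_three (hC : X.IsCluster C w) (p : ℕ → Prop) [DecidablePred p] :
    ∑ j ∈ (X.node 4 w).members with p j, (X.node 4 w).mail 3 j =
      #{z ∈ C | p (relayId X.graph X.id C w z)} := by
  rw [card_eq_sum_card_fiberwise (f := relayId X.graph X.id C w)
    (t := {j ∈ (X.node 4 w).members | p j})]
  · refine sum_congr rfl fun j hj => ?_
    obtain ⟨hj, hp⟩ := mem_filter.1 hj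
    obtain ⟨z, hz, hwz, rfl⟩ := (hC.mem_members hC.leader_mem four_pos).1 hj
    have hclients : X.mail 3 w (X.id z) = #{z' ∈ C | relayId X.graph X.id C w z' = X.id z} := by
      rw [mail_eq hwz, Node.send, hC.clients_eq hz (by norm_num), card_map,
        Params.mod_two_pow_bits (hC.card_filter_le_maxValue _)]
    rw [node_mail, if_pos (by norm_num), hclients, filter_filter]
    congr 1
    exact filter_congr fun z' _ => ⟨fun h => ⟨h ▸ hp, h⟩, And.right⟩
  · intro z hz
    obtain ⟨hz, hp⟩ := mem_filter.1 hz
    obtain ⟨y, hy, -, hyw, hid⟩ := hC.isDense.exists_relay hC.leader_mem hz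
    exact mem_coe.2 <| mem_filter.2
      ⟨(hC.mem_members hC.leader_mem four_pos).2 ⟨y, hy, hyw.symm, hid⟩, hp⟩

theorem mail_four (hC : X.IsCluster C w) (h : X.graph.Adj x w) :
    X.mail 4 x (X.id w) = Nat.pair #{z ∈ C | relayId X.graph X.id C w z < X.id x} #C := by
  have htotal := hC.sum_mail_three fun _ => True
  simp only [filter_true] at htotal
  rw [mail_eq h, Node.send, htotal, hC.sum_mail_three (· < X.id x),
    Params.pair_mod_two_pow_bits (hC.card_filter_le_maxValue _) hC.card_le_maxValue]

theorem mail_five (hC : X.IsCluster C w) (hx : x ∈ C) :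
    X.mail 5 x (relayId X.graph X.id C w x) = Nat.pair (label X.graph X.id C w x) #C := by
  obtain ⟨y, hy, hxy, hyw, hid⟩ := hC.isDense.exists_relay hC.leader_mem hx
  have hclients : #{j ∈ (X.node 5 y).clients | j < X.id x} = #{z ∈ C |
      relayId X.graph X.id C w z = relayId X.graph X.id C w x ∧ X.id z < X.id x} := by
    rw [hC.clients_eq hy (by norm_num), filter_map, card_map, filter_filter, hid]
    rfl
  rw [← hid, mail_eq hxy, Node.send, hC.leader_eq hy (by norm_num) hyw, node_mail,
    if_pos (by norm_num), hC.mail_four hyw, Nat.unpair_pair, hclients, hid, ← label_eq_add_card,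
    Params.pair_mod_two_pow_bits ((label_lt_card hx).le.trans hC.card_le_maxValue)
      hC.card_le_maxValue]

theorem label_eq (hC : X.IsCluster C w) (hx : x ∈ C) (ht : 5 < t) :
    (X.node t x).label = label X.graph X.id C w x := by
  rw [Node.label, node_mail, if_pos ht, hC.relay_eq hx (by omega), hC.mail_five hx, Nat.unpair_pair]

theorem size_eq (hC : X.IsCluster C w) (hx : x ∈ C) (ht : 5 < t) : (X.node t x).size = #C := by
  rw [Node.size, node_mail, if_pos ht, hC.relay_eq hx (by omega), hC.mail_five hx, Nat.unpair_pair]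

theorem labelOf_eq (hC : X.IsCluster C w) (hz : z ∈ C) (h : X.graph.Adj x z) (ht : 6 < t) :
    (X.node t x).labelOf (X.id z) = label X.graph X.id C w z := by
  rw [Node.labelOf, node_mail, if_pos ht, mail_eq h, Node.send, hC.label_eq hz (by norm_num),
    Params.mod_two_pow_bits ((label_lt_card hz).le.trans hC.card_le_maxValue)]

end Labels

end IsCluster

section Phases

variable {V : Type} (X : Execution V) (C : Finset V) (w : V)

/-- The graph of the cluster in terms of labels. -/
noncomputable def clusterGraph : SimpleGraph ℕ := labelGraph X.graph C (label X.graph X.id C w)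

/-- The random number for the middle node of a trial is drawn by the first end of the non-edge. -/
noncomputable def trialIndex (q : Trial) : V × X.params.Index :=
  (nodeWithLabel X.graph X.id C w q.fst, X.params.index q.phase q.snd q.index)

/-- All random numbers of the nodes. -/
def seedAt (i : V × X.params.Index) : Fin X.params.maxSize.factorial := X.seed i.1 i.2

/-- The middle nodes tried for the non-edges of the cluster in phase `p`. -/
noncomputable def clusterTries (p : ℕ) : ℕ → ℕ → Finset ℕ :=
  drawn X.params.phases X.params.lastTrials
    (fun a : Fin X.params.maxSize.factorial => (a : ℕ) % #C) (X.trialIndex C w) X.seedAt p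

/-- The partial overlay of the cluster after `p` phases. -/
noncomputable def overlay (p : ℕ) : PartialOverlay :=
  randomOverlay #C (X.clusterGraph C w) X.params.phases X.params.lastTrials
    (fun a : Fin X.params.maxSize.factorial => (a : ℕ) % #C) (X.trialIndex C w) X.seedAt p

/-- In phase `p`, the node with label `c` connects those with the labels `u` and `v`. -/
def ConnectsIn (p c u v : ℕ) : Prop :=
  (X.overlay C w p).ConnectsAt #C (X.clusterGraph C w) (X.clusterTries C w p) c u v

/-- At the start of phase `p`, the nodes of the cluster store the partial overlay. -/
def Simulates [Fintype V] (p : ℕ) : Prop :=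
  ∀ x ∈ C, (X.node (2 * p + 7) x).mid = (X.overlay C w p).mid (label X.graph X.id C w x) ∧
    (X.node (2 * p + 7) x).serves = (X.overlay C w p).serves (label X.graph X.id C w x)

end Phases

section NodePhases

variable {V : Type} [Fintype V] {X : Execution V} {t p : ℕ} {v : V}

theorem node_of_le_seven (ht : t ≤ 7) :
    (X.node t v).mid = (fun _ => none) ∧ (X.node t v).serves = ∅ := by
  induction t with
  | zero => exact ⟨rfl, rfl⟩
  | succ t ih =>
    rw [node_succ, Node.recv_of_lt ht]
    exact ih (Nat.le_of_succ_le ht)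

theorem node_request_round : (X.node (2 * p + 8) v).mid = (X.node (2 * p + 7) v).mid ∧
    (X.node (2 * p + 8) v).serves = (X.node (2 * p + 7) v).serves := by
  rw [node_succ, Node.recv_request_round]
  exact ⟨rfl, rfl⟩

end NodePhases

namespace IsCluster

section Simulation

variable {V : Type} {X : Execution V} {C : Finset V} {w x z : V} {t p : ℕ}

theorem isValid_overlay : (X.overlay C w p).IsValid #C (X.clusterGraph C w) :=
  isValid_randomOverlay p

theorem clusterGraph_adj_iff (hx : x ∈ C) {d : ℕ} :
    (X.clusterGraph C w).Adj (label X.graph X.id C w x) d ↔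
      ∃ z ∈ C, X.graph.Adj x z ∧ label X.graph X.id C w z = d :=
  labelGraph_adj_iff bijOn_label hx

theorem exists_connectsIn_of_overlay_mid {q u v c : ℕ} (h : (X.overlay C w q).mid u v = some c) :
    ∃ p < q, X.ConnectsIn C w p c u v := by
  induction q with
  | zero => cases h
  | succ q ih =>
    rcases PartialOverlay.of_step_mid_eq_some h with h | h
    · obtain ⟨p, hp, h⟩ := ih h
      exact ⟨p, hp.trans q.lt_succ_self, h⟩
    · exact ⟨q, q.lt_succ_self, h⟩

variable [Fintype V]

theorem exists_members_iff (hC : X.IsCluster C w) (hx : x ∈ C) (ht : 6 < t) {d : ℕ}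
    {q : ℕ → Prop} :
    (∃ i ∈ (X.node t x).members, (X.node t x).labelOf i = d ∧ q i) ↔
      ∃ z ∈ C, X.graph.Adj x z ∧ label X.graph X.id C w z = d ∧ q (X.id z) := by
  constructor
  · rintro ⟨i, hi, hd, hq⟩
    obtain ⟨z, hz, hxz, rfl⟩ := (hC.mem_members hx (by omega)).1 hi
    exact ⟨z, hz, hxz, (hC.labelOf_eq hz hxz ht).symm.trans hd, hq⟩
  · rintro ⟨z, hz, hxz, hd, hq⟩
    exact ⟨X.id z, (hC.mem_members hx (by omega)).2 ⟨z, hz, hxz, rfl⟩,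
      (hC.labelOf_eq hz hxz ht).trans hd, hq⟩

theorem nbrLabels_eq (hC : X.IsCluster C w) (hx : x ∈ C) (ht : 6 < t) :
    (X.node t x).nbrLabels = (X.clusterGraph C w).neighborSet (label X.graph X.id C w x) := by
  ext d
  rw [SimpleGraph.mem_neighborSet, clusterGraph_adj_iff hx]
  simpa [Node.nbrLabels] using hC.exists_members_iff hx ht (d := d) (q := fun _ => True)

theorem tries_eq (hC : X.IsCluster C w) (hx : x ∈ C) (ht : 5 < t) :
    (X.node t x).tries X.params p = X.clusterTries C w p (label X.graph X.id C w x) := by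
  funext v
  simp only [Node.tries, clusterTries, drawn, trialIndex, nodeWithLabel_label hx, seedAt,
    hC.size_eq hx ht, node_static.2.2.2]

theorem mail_request_eq_succ_iff (hC : X.IsCluster C w) (hp : X.Simulates C w p) (hz : z ∈ C)
    (hx : x ∈ C) (h : X.graph.Adj x z) {v : ℕ} : X.mail (2 * p + 7) x (X.id z) = v + 1 ↔
      IsLeast ((X.overlay C w p).wishesOf #C (X.clusterGraph C w) (X.clusterTries C w p)
        (label X.graph X.id C w z) (label X.graph X.id C w x)) v := by
  rw [mail_eq h, Node.send_request_round, Node.request, hC.size_eq hz (by omega),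
    hC.label_eq hz (by omega), hC.nbrLabels_eq hz (by omega), (hp z hz).1,
    hC.tries_eq hz (by omega), hC.labelOf_eq hx h.symm (by omega), ← PartialOverlay.wishesOf,
    ← least_eq_some_iff, Params.mod_two_pow_bits]
  · cases least _ <;> simp
  · cases hv : least _ with
    | none => exact Nat.zero_le _
    | some v => exact (Nat.succ_le_of_lt (least_mem hv).2.1).trans hC.card_le_maxValue

theorem connects_eq (hC : X.IsCluster C w) (hp : X.Simulates C w p) (hx : x ∈ C) :
    (X.node (2 * p + 8) x).connects p = X.ConnectsIn C w p (label X.graph X.id C w x) := by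
  have hrequests : (fun u v => ∃ i ∈ (X.node (2 * p + 8) x).members,
      (X.node (2 * p + 8) x).labelOf i = u ∧ (X.node (2 * p + 8) x).mail (2 * p + 7) i = v + 1) =
      (X.overlay C w p).Requests #C (X.clusterGraph C w) (X.clusterTries C w p)
        (label X.graph X.id C w x) := by
    funext u v
    rw [node_mail, if_pos (by omega), hC.exists_members_iff hx (by omega),
      PartialOverlay.Requests, clusterGraph_adj_iff hx]
    refine propext ⟨?_, ?_⟩
    · rintro ⟨z, hz, hxz, rfl, h⟩
      exact ⟨⟨z, hz, hxz, rfl⟩, (hC.mail_request_eq_succ_iff hp hz hx hxz).1 h⟩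
    · rintro ⟨⟨z, hz, hxz, rfl⟩, h⟩
      exact ⟨z, hz, hxz, rfl, (hC.mail_request_eq_succ_iff hp hz hx hxz).2 h⟩
  funext u v
  rw [Node.connects, hrequests, hC.nbrLabels_eq hx (by omega), node_request_round.2, (hp x hx).2]
  rfl

theorem mail_answer (hC : X.IsCluster C w) (hp : X.Simulates C w p) (hz : z ∈ C) (hx : x ∈ C)
    (h : X.graph.Adj x z) :
    (X.mail (2 * p + 8) x (X.id z) = 0 ∧
      ∀ v, ¬ X.ConnectsIn C w p (label X.graph X.id C w z) (label X.graph X.id C w x) v) ∨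
    ∃ y ∈ C, X.mail (2 * p + 8) x (X.id z) = Nat.pair (label X.graph X.id C w y + 1) (X.id y) ∧
      X.ConnectsIn C w p (label X.graph X.id C w z) (label X.graph X.id C w x)
        (label X.graph X.id C w y) := by
  rw [mail_eq h, Node.send_answer_round, Node.answer, hC.labelOf_eq hx h.symm (by omega),
    hC.connects_eq hp hz]
  cases hj : least _ with
  | none =>
    refine Or.inl ⟨Nat.zero_mod _, fun v hv => ?_⟩
    obtain ⟨y, hy, hzy, rfl⟩ := (clusterGraph_adj_iff hz).1
      (isValid_overlay.of_connectsAt (PartialOverlay.connectsAt_comm.1 hv)).2.1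
    rw [least_eq_none_iff, Set.eq_empty_iff_forall_notMem] at hj
    refine hj (X.id y) ⟨(hC.mem_members hz (by omega)).2 ⟨y, hy, hzy, rfl⟩, ?_⟩
    rwa [hC.labelOf_eq hy hzy (by omega)]
  | some j =>
    obtain ⟨hj, hconnects⟩ := least_mem hj
    obtain ⟨y, hy, hzy, rfl⟩ := (hC.mem_members hz (by omega)).1 hj
    rw [hC.labelOf_eq hy hzy (by omega)] at hconnects
    rw [Option.elim_some, hC.labelOf_eq hy hzy (by omega)]
    exact Or.inr ⟨y, hy, Params.pair_mod_two_pow_bits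
      ((Nat.succ_le_of_lt (label_lt_card hy)).trans hC.card_le_maxValue) (hC.id_le y), hconnects⟩

theorem mail_answer_eq_succ_iff (hC : X.IsCluster C w) (hp : X.Simulates C w p) (hz : z ∈ C)
    (hx : x ∈ C) (h : X.graph.Adj x z) {v : ℕ} :
    (X.mail (2 * p + 8) x (X.id z)).unpair.1 = v + 1 ↔
      X.ConnectsIn C w p (label X.graph X.id C w z) (label X.graph X.id C w x) v := by
  rcases hC.mail_answer hp hz hx h with ⟨hmail, hnot⟩ | ⟨y, -, hmail, hconnects⟩ <;>
    rw [hmail]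
  · simp [hnot v]
  · rw [Nat.unpair_pair, Nat.add_right_cancel_iff]
    exact ⟨fun e => e ▸ hconnects, fun hv => hconnects.unique hv⟩

theorem simulates (hC : X.IsCluster C w) (p : ℕ) : X.Simulates C w p := by
  induction p with
  | zero => exact fun x _ => node_of_le_seven le_rfl
  | succ p ih =>
    refine fun x hx => ⟨funext fun y => ?_, ?_⟩
    · have hanswers : {c | ∃ i ∈ (X.node (2 * p + 8) x).members,
          (X.node (2 * p + 8) x).labelOf i = c ∧
            (X.mail (2 * p + 8) x i).unpair.1 = y + 1} =
          {c | X.ConnectsIn C w p c (label X.graph X.id C w x) y} := by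
        ext c
        rw [Set.mem_ofPred_eq, hC.exists_members_iff hx (by omega)]
        constructor
        · rintro ⟨z, hz, hxz, rfl, h⟩
          exact (hC.mail_answer_eq_succ_iff ih hz hx hxz).1 h
        · intro h
          obtain ⟨z, hz, hxz, rfl⟩ := (clusterGraph_adj_iff hx).1
            (isValid_overlay.of_connectsAt h).2.1.symm
          exact ⟨z, hz, hxz, rfl, (hC.mail_answer_eq_succ_iff ih hz hx hxz).2 h⟩
      rw [show 2 * (p + 1) + 7 = 2 * p + 8 + 1 by ring, node_succ, Node.recv_answer_round_mid,
        hanswers, node_request_round.1, (ih x hx).1]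
      rfl
    · rw [show 2 * (p + 1) + 7 = 2 * p + 8 + 1 by ring, node_succ, Node.recv_answer_round_serves,
        hC.connects_eq ih hx, node_request_round.2, (ih x hx).2]
      rfl

theorem exists_of_knows (hC : X.IsCluster C w) (hx : x ∈ C) {y i : ℕ} (ht : 6 < t)
    (h : (X.node t x).Knows y i) : ∃ v ∈ C, X.id v = i ∧ label X.graph X.id C w v = y := by
  obtain ⟨p, j, hj, hmail⟩ := h
  obtain ⟨z, hz, hxz, rfl⟩ := (hC.mem_members hx (by omega)).1 hj
  rw [node_mail] at hmail
  split_ifs at hmail with hp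
  · rcases hC.mail_answer (hC.simulates p) hz hx hxz with ⟨hmail', -⟩ | ⟨v, hv, hmail', -⟩ <;>
      have hpair := hmail'.symm.trans hmail
    · exact absurd (congrArg (fun k => k.unpair.1) hpair) (by simp)
    · rw [Nat.pair_eq_pair, Nat.add_right_cancel_iff] at hpair
      exact ⟨v, hv, hpair.2, hpair.1⟩
  · exact absurd (congrArg (fun k => k.unpair.1) hmail) (by simp)

theorem knows_of_overlay_mid (hC : X.IsCluster C w) (hx : x ∈ C) (hz : z ∈ C) {q c : ℕ}
    (h : (X.overlay C w q).mid (label X.graph X.id C w x) (label X.graph X.id C w z) = some c) :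
    (X.node (2 * q + 7) x).Knows (label X.graph X.id C w z) (X.id z) := by
  obtain ⟨p, hp, hconnects⟩ := exists_connectsIn_of_overlay_mid h
  obtain ⟨y, hy, hxy, rfl⟩ := (clusterGraph_adj_iff hx).1
    (isValid_overlay.of_connectsAt hconnects).2.1.symm
  refine ⟨p, X.id y, (hC.mem_members hx (by omega)).2 ⟨y, hy, hxy, rfl⟩, ?_⟩
  rw [node_mail, if_pos (by omega)]
  rcases hC.mail_answer (hC.simulates p) hy hx hxy with ⟨-, hnot⟩ | ⟨v, hv, hmail, hconnects'⟩
  · exact absurd hconnects (hnot _)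
  · rw [hmail, bijOn_label.injOn hv hz (hconnects'.unique hconnects)]

theorem output_eq_some_iff (hC : X.IsCluster C w) (hx : x ∈ C) {q i j : ℕ} :
    (X.node (2 * q + 7) x).output i = some j ↔ ∃ v ∈ C, ∃ z ∈ C, X.id v = i ∧ X.id z = j ∧
      (X.overlay C w q).mid (label X.graph X.id C w x) (label X.graph X.id C w v) =
        some (label X.graph X.id C w z) := by
  have hset : {j | j ∈ (X.node (2 * q + 7) x).members ∧ ∃ y, (X.node (2 * q + 7) x).Knows y i ∧
      (X.node (2 * q + 7) x).mid y = some ((X.node (2 * q + 7) x).labelOf j)} =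
      {j | ∃ v ∈ C, ∃ z ∈ C, X.id v = i ∧ X.id z = j ∧
        (X.overlay C w q).mid (label X.graph X.id C w x) (label X.graph X.id C w v) =
          some (label X.graph X.id C w z)} := by
    ext j
    rw [Set.mem_ofPred_eq, Set.mem_ofPred_eq, hC.mem_members hx (by omega), (hC.simulates q x hx).1]
    constructor
    · rintro ⟨⟨z, hz, hxz, rfl⟩, y, hknows, hmid⟩
      obtain ⟨v, hv, rfl, rfl⟩ := hC.exists_of_knows hx (by omega) hknows
      rw [hC.labelOf_eq hz hxz (by omega)] at hmid
      exact ⟨v, hv, z, hz, rfl, rfl, hmid⟩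
    · rintro ⟨v, hv, z, hz, rfl, rfl, hmid⟩
      have hxz : X.graph.Adj x z :=
        (labelGraph_adj_label_iff bijOn_label hx hz).1 (isValid_overlay.adj hmid).symm
      refine ⟨⟨z, hz, hxz, rfl⟩, _, hC.knows_of_overlay_mid hx hv hmid, ?_⟩
      rw [hC.labelOf_eq hz hxz (by omega), hmid]
  rw [Node.output, hset, least_eq_some_iff]
  refine ⟨And.left, fun h => ⟨h, ?_⟩⟩
  rintro _ ⟨v', -, z', hz', hi', rfl, hmid'⟩
  obtain ⟨v, hv, z, hz, rfl, rfl, hmid⟩ := h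
  obtain rfl := X.id.injective hi'
  rw [hmid, Option.some_inj] at hmid'
  rw [bijOn_label.injOn hz hz' hmid']

end Simulation

end IsCluster

end Execution

section Outcome

variable {V : Type} [Fintype V] [DecidableEq V] (G : SimpleGraph V) (C : Finset V)

/-- The outputs of the nodes describe a clique overlay of `C` of congestion at most 2. -/
def ComputesOverlay [DecidableRel G.Adj] (id : V ↪ ℕ) (out : V → ℕ → Option ℕ) : Prop :=
  ∃ O : Finset (Sym2 V × V),
    IsCliqueOverlay G C O ∧ overlayCongestion G O ≤ 2 ∧ KnowsOverlay G id C O out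

open scoped Classical in
/-- The paths of length 2 that a partial overlay in terms of the labels `lab` consists of. -/
noncomputable def pathsOf (lab : V → ℕ) (s : PartialOverlay) : Finset (Sym2 V × V) :=
  {q | q.2 ∈ C ∧ ∃ u ∈ C, ∃ v ∈ C, q.1 = s(u, v) ∧ s.mid (lab u) (lab v) = some (lab q.2)}

variable {G C} {lab : V → ℕ} {s : PartialOverlay} {u v m : V}

theorem mk_mem_pathsOf (hs : ∀ c d, s.mid c d = s.mid d c) : (s(u, v), m) ∈ pathsOf C lab s ↔
    u ∈ C ∧ v ∈ C ∧ m ∈ C ∧ s.mid (lab u) (lab v) = some (lab m) := by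
  simp only [pathsOf, mem_filter_univ, Sym2.eq_iff]
  constructor
  · rintro ⟨hm, u', hu, v', hv, ⟨rfl, rfl⟩ | ⟨rfl, rfl⟩, h⟩
    · exact ⟨hu, hv, hm, h⟩
    · exact ⟨hv, hu, hm, hs _ _ ▸ h⟩
  · rintro ⟨hu, hv, hm, h⟩
    exact ⟨hm, u, hu, v, hv, Or.inl ⟨rfl, rfl⟩, h⟩

theorem card_pathsOf_through_le_one (hlab : Set.InjOn lab C)
    (hs : s.IsValid #C (labelGraph G C lab)) (u m : V) :
    #{q ∈ pathsOf C lab s | u ∈ q.1 ∧ q.2 = m} ≤ 1 := by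
  refine card_le_one.2 ?_
  simp only [mem_filter]
  rintro ⟨_, _⟩ ⟨hq, ⟨v, rfl⟩, rfl⟩ ⟨_, _⟩ ⟨hq', ⟨v', rfl⟩, rfl⟩
  obtain ⟨-, hv, -, h⟩ := (mk_mem_pathsOf hs.mid_comm).1 hq
  obtain ⟨-, hv', -, h'⟩ := (mk_mem_pathsOf hs.mid_comm).1 hq'
  rw [hlab hv hv' (hs.mid_inj h h')]

theorem edgeOccurrences_pathsOf_le_two (hlab : Set.InjOn lab C)
    (hs : s.IsValid #C (labelGraph G C lab)) (e : Sym2 V) :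
    edgeOccurrences (pathsOf C lab s) e ≤ 2 := by
  induction e with
  | _ a b =>
    have hsub : {q ∈ pathsOf C lab s | ∃ x ∈ q.1, s(a, b) = s(x, q.2)} ⊆
        {q ∈ pathsOf C lab s | a ∈ q.1 ∧ q.2 = b} ∪
          {q ∈ pathsOf C lab s | b ∈ q.1 ∧ q.2 = a} := by
      intro q hq
      obtain ⟨hq, x, hx, he⟩ := mem_filter.1 hq
      simp only [mem_union, mem_filter, hq, true_and]
      rcases Sym2.eq_iff.1 he with ⟨rfl, rfl⟩ | ⟨rfl, rfl⟩
      · exact Or.inl ⟨hx, rfl⟩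
      · exact Or.inr ⟨hx, rfl⟩
    exact (card_le_card hsub).trans <| (card_union_le _ _).trans <| add_le_add
      (card_pathsOf_through_le_one hlab hs a b) (card_pathsOf_through_le_one hlab hs b a)

theorem isTwoPath_of_mem_pathsOf (hlab : Set.BijOn lab C (range #C))
    (hs : s.IsValid #C (labelGraph G C lab)) {q : Sym2 V × V} (hq : q ∈ pathsOf C lab s) :
    IsTwoPath G C q := by
  obtain ⟨e, m⟩ := q
  induction e with
  | _ u v =>
    obtain ⟨hu, hv, hm, h⟩ := (mk_mem_pathsOf hs.mid_comm).1 hq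
    refine ⟨fun hd => (hs.isNonEdge h).2.2.1 (congrArg lab (Sym2.mk_isDiag_iff.1 hd)), hm, ?_⟩
    intro x hx
    rcases Sym2.mem_iff.1 hx with rfl | rfl
    · exact ⟨hu, (labelGraph_adj_label_iff hlab hu hm).1 (hs.adj h).symm⟩
    · rw [hs.mid_comm] at h
      exact ⟨hv, (labelGraph_adj_label_iff hlab hv hm).1 (hs.adj h).symm⟩

theorem computesOverlay_of_partialOverlay [DecidableRel G.Adj] {id : V ↪ ℕ}
    {out : V → ℕ → Option ℕ} (hlab : Set.BijOn lab C (range #C))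
    (hs : s.IsValid #C (labelGraph G C lab))
    (hmid : ∀ c d, IsNonEdge (labelGraph G C lab) (range #C) c d → s.mid c d ≠ none)
    (hout : ∀ u ∈ C, ∀ i j, out u i = some j ↔ ∃ v ∈ C, ∃ z ∈ C, id v = i ∧ id z = j ∧
      s.mid (lab u) (lab v) = some (lab z)) :
    ComputesOverlay G C id out := by
  have hpath : ∀ u v, IsNonEdge G C u v → ∃ z, (s(u, v), z) ∈ pathsOf C lab s := by
    intro u v huv
    obtain ⟨c, hc⟩ := Option.ne_none_iff_exists'.1 <|
      hmid _ _ ((isNonEdge_labelGraph_iff hlab huv.1 huv.2.1).2 huv)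
    obtain ⟨z, hz, -, rfl⟩ := (labelGraph_adj_iff hlab huv.1).1 (hs.adj hc).symm
    exact ⟨z, (mk_mem_pathsOf hs.mid_comm).2 ⟨huv.1, huv.2.1, hz, hc⟩⟩
  refine ⟨pathsOf C lab s, ⟨fun _ => isTwoPath_of_mem_pathsOf hlab hs, hpath⟩,
    Finset.sup_le fun e _ => edgeOccurrences_pathsOf_le_two hlab.injOn hs e, ?_, ?_⟩
  · intro u v huv
    obtain ⟨z, hz⟩ := hpath u v huv
    obtain ⟨hu, hv, hzC, h⟩ := (mk_mem_pathsOf hs.mid_comm).1 hz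
    exact ⟨z, hz, (hout u hu _ _).2 ⟨v, hv, z, hzC, rfl, rfl, h⟩,
      (hout v hv _ _).2 ⟨u, hu, z, hzC, rfl, rfl, hs.mid_comm _ _ ▸ h⟩⟩
  · refine fun u hu i hi => Option.eq_none_iff_forall_ne_some.2 fun j hj => ?_
    obtain ⟨v, hv, z, -, hvi, -, h⟩ := (hout u hu i j).1 hj
    exact hi v ((isNonEdge_labelGraph_iff hlab hu hv).1 (hs.isNonEdge h)) hvi

end Outcome

namespace Execution

section Seeds

variable {V : Type} {X : Execution V} {C : Finset V} {w : V}

/-- The execution with other random numbers. -/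
abbrev withSeed (X : Execution V) (ω : V → X.params.Seed) : Execution V := { X with seed := ω }

theorem IsCluster.withSeed (hC : X.IsCluster C w) (ω : V → X.params.Seed) :
    (X.withSeed ω).IsCluster C w := { hC with }

theorem IsCluster.isDense_clusterGraph (hC : X.IsCluster C w) :
    IsDense (X.clusterGraph C w) (range #C) :=
  isDense_labelGraph bijOn_label hC.isDense

theorem IsCluster.injOn_trialIndex (hC : X.IsCluster C w) (hl : 0 < X.params.lastTrials) :
    Set.InjOn (X.trialIndex C w) (trials #C X.params.phases X.params.lastTrials) := by
  have hsize := hC.card_le_maxSize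
  have hschedule : ∀ t, schedule X.params.phases X.params.lastTrials t ≤ X.params.lastTrials := by
    intro t
    unfold schedule
    split_ifs <;> omega
  rintro ⟨t, u, v, j⟩ ⟨ht, huv, hv, hj⟩ ⟨t', u', v', j'⟩ ⟨ht', huv', hv', hj'⟩ h
  have hj := hj.trans_le (hschedule t)
  have hj' := hj'.trans_le (hschedule t')
  dsimp only at ht ht' huv huv' hv hv' hj hj'
  simp only [trialIndex, Params.index, Prod.mk.injEq, Fin.ext_iff, Fin.val_ofNat] at h
  obtain ⟨hnode, ht_eq, hv_eq, hj_eq⟩ := h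
  rw [Nat.mod_eq_of_lt (by omega), Nat.mod_eq_of_lt (by omega)] at ht_eq hv_eq hj_eq
  rw [Trial.mk.injEq, ← label_nodeWithLabel (huv.trans hv), hnode,
    label_nodeWithLabel (huv'.trans hv')]
  exact ⟨ht_eq, rfl, hv_eq, hj_eq⟩

end Seeds

section Failure

variable {V : Type} [Fintype V] {X : Execution V} {C : Finset V} {w : V}

theorem IsCluster.computesOverlay [DecidableEq V] (hC : X.IsCluster C w)
    (hmid : ∀ c d, IsNonEdge (X.clusterGraph C w) (range #C) c d →
      (X.overlay C w (X.params.phases + 1)).mid c d ≠ none) :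
    ComputesOverlay X.graph C X.id fun v => (X.node X.params.rounds v).output :=
  computesOverlay_of_partialOverlay bijOn_label IsCluster.isValid_overlay hmid
    fun _ hu _ _ => hC.output_eq_some_iff hu

theorem IsCluster.unifProb_not_computesOverlay_le [DecidableEq V] (hC : X.IsCluster C w) {r : ℕ}
    (hl : 0 < X.params.lastTrials) (hr : ∀ m < r, 8 * (m * X.params.lastTrials) ≤ #C) :
    unifProb {ω : V → X.params.Seed | ¬ ComputesOverlay X.graph C X.id
        fun v => ((X.withSeed ω).node X.params.rounds v).output} ≤
      #C * ((#C / 8).choose r * (3 / 4) ^ (X.params.phases * r)) +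
        #C ^ 2 * (3 / 4) ^ X.params.lastTrials := by
  have hpos : 0 < #C := card_pos.2 ⟨w, hC.leader_mem⟩
  have : Nonempty (Fin X.params.maxSize.factorial) := ⟨⟨0, X.params.maxSize.factorial_pos⟩⟩
  refine le_trans ?_ <| unifProb_exists_mid_eq_none_le
    (isUniformBelow_mod hpos (Nat.dvd_factorial hpos hC.card_le_maxSize)) (hC.injOn_trialIndex hl)
    hC.isDense_clusterGraph hr
  rw [← unifProb_preimage_equiv (Equiv.curry V X.params.Index (Fin _)).symm]
  refine unifProb_mono fun ω hω => ?_
  by_contra h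
  refine hω ((hC.withSeed ω).computesOverlay fun c d hcd hmid => h ⟨c, d, hcd, hmid⟩)

end Failure

end Execution

section Estimates

theorem natCast_size_le_log {n : ℕ} (hn : 2 ≤ n) : (n.size : ℝ) ≤ 3 * Real.log n := by
  have hsize : 0 < n.size := Nat.size_pos.2 (by omega)
  have hpow : ((2 ^ (n.size - 1) : ℕ) : ℝ) ≤ n := by
    exact_mod_cast Nat.lt_size.1 (Nat.sub_lt hsize one_pos)
  have hlog := Real.log_le_log (by positivity) hpow
  rw [Nat.cast_pow, Real.log_pow, Nat.cast_sub hsize] at hlog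
  have hmono : Real.log 2 ≤ Real.log n := Real.log_le_log two_pos (by exact_mod_cast hn)
  have := Real.log_two_gt_d9
  push_cast at hlog
  nlinarith

theorem natCast_clog_two_le_log (m : ℕ) : (Nat.clog 2 m : ℝ) ≤ 1 + 3 / 2 * Real.log m := by
  have hlog : 0 ≤ Real.log m := Real.log_natCast_nonneg m
  have hlogb : Real.logb 2 m ≤ 3 / 2 * Real.log m := by
    rw [Real.logb, div_le_iff₀ (Real.log_pos one_lt_two)]
    nlinarith [Real.log_two_gt_d9]
  have hceil := Nat.ceil_lt_add_one (div_nonneg hlog (Real.log_pos one_lt_two).le)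
  rw [← Nat.cast_ofNat, Real.log_div_log, Real.natCeil_logb_natCast, Nat.cast_ofNat] at hceil
  linarith

theorem three_quarters_pow_le (m : ℕ) : (3 / 4 : ℝ) ^ (3 * m) ≤ (1 / 2) ^ m := by
  rw [pow_mul]
  exact pow_le_pow_left₀ (by norm_num) (by norm_num) m

theorem half_pow_mul_size_le {n : ℕ} (hn : 0 < n) (m : ℕ) :
    (1 / 2 : ℝ) ^ (m * n.size) ≤ (1 / n) ^ m := by
  rw [mul_comm, pow_mul, div_pow, one_pow]
  gcongr
  exact_mod_cast (Nat.lt_size_self n).le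

theorem choose_le_of_le_mul {D l r : ℕ} (h : D ≤ l * r) : (D.choose r : ℝ) ≤ (3 * l) ^ r := by
  have hfactorial : (r : ℝ) ^ r / r.factorial ≤ 3 ^ r :=
    calc (r : ℝ) ^ r / r.factorial ≤ Real.exp r := Real.pow_div_factorial_le_exp _ r.cast_nonneg r
      _ = Real.exp 1 ^ r := (Real.exp_one_pow r).symm
      _ ≤ 3 ^ r := by gcongr; exact Real.exp_one_lt_three.le
  calc (D.choose r : ℝ) ≤ (D : ℝ) ^ r / r.factorial := Nat.choose_le_pow_div r D
    _ ≤ ((l * r : ℕ) : ℝ) ^ r / r.factorial := by gcongr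
    _ = l ^ r * ((r : ℝ) ^ r / r.factorial) := by push_cast; ring
    _ ≤ l ^ r * 3 ^ r := by gcongr
    _ = (3 * l) ^ r := by rw [mul_comm, mul_pow]

theorem choose_mul_three_quarters_pow_le {D l r τ : ℕ} (hD : D ≤ l * r) (hl : 6 * l ≤ 2 ^ τ) :
    (D.choose r : ℝ) * (3 / 4) ^ (3 * τ * r) ≤ (1 / 2) ^ r := by
  have hratio : 3 * l * (1 / 2 : ℝ) ^ τ ≤ 1 / 2 := by
    have : (6 * l : ℝ) ≤ 2 ^ τ := by exact_mod_cast hl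
    rw [div_pow, one_pow, mul_one_div, div_le_div_iff₀ (by positivity) two_pos]
    linarith
  calc (D.choose r : ℝ) * (3 / 4) ^ (3 * τ * r) ≤ (3 * l) ^ r * ((1 / 2) ^ τ) ^ r := by
        rw [pow_mul]
        gcongr
        · exact choose_le_of_le_mul hD
        · exact three_quarters_pow_le τ
    _ ≤ (1 / 2) ^ r := by
        rw [← mul_pow]
        exact pow_le_pow_left₀ (by positivity) hratio r

end Estimates

/-- The parameters for `n` nodes, IDs below `n ^ a` and failure probability `1 / n ^ k`. The last
phase fails at a non-edge with probability `(3 / 4) ^ lastTrials ≤ 1 / n ^ (k + 4)`. The number of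
phases before it is such that `(3 / 4) ^ phases ≤ 1 / (6 * lastTrials)`, which outweighs the number
of choices of the non-edges at a node that may remain. -/
def overlayParams (a k n : ℕ) : Params where
  maxSize := n
  phases := 3 * Nat.clog 2 (6 * (3 * (k + 4) * n.size))
  lastTrials := 3 * (k + 4) * n.size
  maxValue := n ^ a + n

/-- The algorithm that computes clique overlays in networks of `n` nodes. -/
noncomputable def overlayAlgorithm (a k n : ℕ) : CongestAlgorithm CliqueInput (ℕ → Option ℕ) :=
  (overlayCode (overlayParams a k n)).toCongest (overlayParams a k n).bits
    (overlayParams a k n).rounds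

section Parameters

variable {a k n : ℕ}

theorem lastTrials_pos (hn : 0 < n) : 0 < (overlayParams a k n).lastTrials := by
  have := Nat.size_pos.2 hn
  unfold overlayParams
  positivity

theorem exists_failure_bound_le (hn : 2 ≤ n) {N : ℕ} (hNn : N ≤ n)
    (hN : 24 * (k + 4) ^ 2 * n.size ^ 2 ≤ N) :
    ∃ r : ℕ, (∀ m < r, 8 * (m * (overlayParams a k n).lastTrials) ≤ N) ∧
      (N * ((N / 8).choose r * (3 / 4) ^ ((overlayParams a k n).phases * r)) +
        N ^ 2 * (3 / 4) ^ (overlayParams a k n).lastTrials : ℝ) ≤ 1 / n ^ (k + 1) := by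
  have hl := lastTrials_pos (a := a) (k := k) (n := n) (by omega)
  set l := (overlayParams a k n).lastTrials with hl_def
  have hr_le : (k + 3) * n.size ≤ N / 8 / l := by
    rw [Nat.div_div_eq_div_mul, Nat.le_div_iff_mul_le (by positivity)]
    calc (k + 3) * n.size * (8 * (3 * (k + 4) * n.size))
        = 24 * ((k + 3) * (k + 4)) * n.size ^ 2 := by ring
      _ ≤ 24 * (k + 4) ^ 2 * n.size ^ 2 := by gcongr; nlinarith
      _ ≤ N := hN
  refine ⟨N / 8 / l + 1, fun m hm => ?_, ?_⟩
  · have := (Nat.le_div_iff_mul_le hl).1 (Nat.le_of_lt_succ hm)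
    omega
  set r := N / 8 / l + 1
  have hphases : (N / 8).choose r * (3 / 4 : ℝ) ^ ((overlayParams a k n).phases * r) ≤
      (1 / n) ^ (k + 3) :=
    (choose_mul_three_quarters_pow_le (Nat.lt_mul_div_succ (N / 8) hl).le
      (Nat.le_pow_clog one_lt_two _)).trans <|
    (pow_le_pow_of_le_one (by norm_num) (by norm_num) (hr_le.trans (Nat.le_succ _))).trans
      (half_pow_mul_size_le (by omega) _)
  have hlast : (3 / 4 : ℝ) ^ l ≤ (1 / n) ^ (k + 4) := by
    rw [hl_def, overlayParams, mul_assoc]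
    exact (three_quarters_pow_le _).trans (half_pow_mul_size_le (by omega) _)
  have hn' : (2 : ℝ) ≤ n := by exact_mod_cast hn
  have hNn' : (N : ℝ) ≤ n := by exact_mod_cast hNn
  calc (N * ((N / 8).choose r * (3 / 4) ^ ((overlayParams a k n).phases * r)) +
        N ^ 2 * (3 / 4) ^ l : ℝ)
      ≤ n * (1 / n) ^ (k + 3) + n ^ 2 * (1 / n) ^ (k + 4) := by gcongr
    _ = 2 / n * (1 / n ^ (k + 1)) := by
        simp only [one_div, inv_pow]
        field_simp
        ring
    _ ≤ 1 / n ^ (k + 1) := mul_le_of_le_one_left (by positivity) <| by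
        rwa [div_le_one (by linarith)]

theorem exists_rounds_le_mul_log_log (a k : ℕ) : ∃ K : ℝ, ∀ n : ℕ, 3 ≤ n →
    ((overlayAlgorithm a k n).rounds : ℝ) ≤ K * Real.log (Real.log n) := by
  have hlog : 1 < Real.log 3 := (Real.lt_log_iff_exp_lt (by norm_num)).2 Real.exp_one_lt_three
  set A := Real.log (Real.log 3)
  set c := Real.log (54 * (k + 4)) with hc
  have hA : 0 < A := Real.log_pos hlog
  have hc0 : 0 ≤ c := Real.log_nonneg (by have : (0 : ℝ) ≤ k := k.cast_nonneg; linarith)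
  refine ⟨(15 + 9 * c) / A + 9, fun n hn => ?_⟩
  have hlog_le : Real.log 3 ≤ Real.log n := Real.log_le_log (by norm_num) (by exact_mod_cast hn)
  have hA_le : A ≤ Real.log (Real.log n) := Real.log_le_log (by linarith) hlog_le
  set l := (overlayParams a k n).lastTrials with hl
  have hlpos : 0 < l := lastTrials_pos (by omega)
  have hlog_l : Real.log (6 * l : ℕ) ≤ c + Real.log (Real.log n) := by
    rw [hc, ← Real.log_mul (by positivity) (by linarith)]
    refine Real.log_le_log (by positivity) ?_
    have := mul_le_mul_of_nonneg_left (natCast_size_le_log (n := n) (by omega))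
      (by positivity : (0 : ℝ) ≤ 18 * (k + 4))
    rw [hl, overlayParams]
    push_cast
    linarith
  have hrounds : ((overlayAlgorithm a k n).rounds : ℝ) = 6 * (Nat.clog 2 (6 * l) : ℕ) + 9 := by
    change ((2 * (3 * Nat.clog 2 (6 * l) + 1) + 7 : ℕ) : ℝ) = _
    push_cast
    ring
  have hK : 15 + 9 * c ≤ (15 + 9 * c) / A * Real.log (Real.log n) := by
    rw [div_mul_eq_mul_div, le_div_iff₀ hA]
    gcongr
  have := natCast_clog_two_le_log (6 * l)
  linarith

theorem msgBits_le_mul_log (hn : 2 ≤ n) :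
    ((overlayAlgorithm a k n).msgBits : ℝ) ≤ 6 * (a + 2) * Real.log n := by
  have hmaxValue : (n ^ a + n).size ≤ (a + 2) * n.size := by
    rw [Nat.size_le]
    calc n ^ a + n ≤ n ^ (a + 1) + n ^ (a + 1) := add_le_add
          (Nat.pow_le_pow_right (by omega) a.le_succ) (Nat.le_self_pow a.succ_ne_zero n)
      _ = 2 * n ^ (a + 1) := (two_mul _).symm
      _ ≤ n * n ^ (a + 1) := Nat.mul_le_mul_right _ hn
      _ = n ^ (a + 2) := (pow_succ' n (a + 1)).symm
      _ < (2 ^ n.size) ^ (a + 2) := Nat.pow_lt_pow_left (Nat.lt_size_self n) (by omega)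
      _ = 2 ^ ((a + 2) * n.size) := by rw [← pow_mul, mul_comm]
  have hbits : ((overlayAlgorithm a k n).msgBits : ℝ) ≤ 2 * ((a + 2) * n.size) := by
    exact_mod_cast Nat.mul_le_mul_left 2 hmaxValue
  have := mul_le_mul_of_nonneg_left (natCast_size_le_log hn) (by positivity : (0 : ℝ) ≤ 2 * (a + 2))
  linarith

end Parameters

section Guarantee

variable {V : Type} [Fintype V] {G : SimpleGraph V} [DecidableRel G.Adj] {ε : ℝ} {C : Finset V}

theorem two_le_card_of_maxDegree_ne_zero (h : G.maxDegree ≠ 0) : 2 ≤ Fintype.card V := by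
  by_contra! hcard
  have : Subsingleton V := Fintype.card_le_one_iff_subsingleton.1 (by omega)
  exact h G.maxDegree_of_subsingleton

variable [DecidableEq V]

theorem isDense_of_isAlmostClique (hC : IsAlmostClique G ε C) (hε : ε ≤ 1 / 15) :
    IsDense G C := by
  intro x hx
  have hsplit : #(G.neighborFinset x ∩ C) + #(nonNbrs G C x) = #C := by
    rw [← card_filter_add_card_filter_not (s := C) (G.Adj x)]
    congr 2 <;> grind [nonNbrs, SimpleGraph.mem_neighborFinset]
  have hsplit' : (#(G.neighborFinset x ∩ C) : ℝ) + #(nonNbrs G C x) = #C := by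
    exact_mod_cast hsplit
  have : (0 : ℝ) ≤ G.maxDegree := Nat.cast_nonneg _
  have := hC.2.1
  have := hC.2.2 x hx
  have : (8 : ℝ) * #(nonNbrs G C x) ≤ #C := by nlinarith
  exact_mod_cast this

theorem mul_size_sq_le_card (hC : IsAlmostClique G ε C) (hε : ε ≤ 1 / 15) {k n : ℕ} (hn : 2 ≤ n)
    (hlog : 216 * (k + 4 : ℝ) ^ 2 * Real.log n ^ 2 < ε * G.maxDegree) :
    24 * (k + 4) ^ 2 * n.size ^ 2 ≤ #C := by
  have hle : ε * (G.maxDegree : ℝ) ≤ #C :=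
    le_trans (by nlinarith [(G.maxDegree.cast_nonneg : (0 : ℝ) ≤ _)]) hC.1
  suffices 24 * (k + 4 : ℝ) ^ 2 * (n.size : ℝ) ^ 2 ≤ #C by exact_mod_cast this
  calc 24 * (k + 4 : ℝ) ^ 2 * (n.size : ℝ) ^ 2
      ≤ 24 * (k + 4 : ℝ) ^ 2 * (3 * Real.log n) ^ 2 := by gcongr; exact natCast_size_le_log hn
    _ = 216 * (k + 4 : ℝ) ^ 2 * Real.log n ^ 2 := by ring
    _ ≤ #C := hlog.le.trans hle

theorem unifProb_not_computesOverlay_le {a k n i : ℕ} (id : V ↪ ℕ) {input : V → CliqueInput}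
    (hcard : Fintype.card V = n) (hn : 2 ≤ n) (hid : ∀ v, id v < n ^ a)
    (hacId : ∀ v j, (input v).acId = some j → j < n ^ a)
    (hleader : ∃! w, w ∈ acNodes input i ∧ (input w).isLeader = true)
    (hdense : IsDense G (acNodes input i))
    (hsize : 24 * (k + 4) ^ 2 * n.size ^ 2 ≤ #(acNodes input i)) :
    unifProb {ω : V → (overlayAlgorithm a k n).Seed | ¬ ComputesOverlay G (acNodes input i) id
        ((overlayAlgorithm a k n).run G id input ω)} ≤ 1 / n ^ (k + 1) := by
  obtain ⟨w, ⟨hw, hw_leader⟩, huniq⟩ := hleader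
  let X : Execution V :=
    { params := overlayParams a k n, graph := G, id := id, input := input,
      seed := fun _ => Classical.arbitrary (overlayAlgorithm a k n).Seed }
  have hcard_le : #(acNodes input i) ≤ n := hcard ▸ card_le_univ _
  have hcluster : X.IsCluster (acNodes input i) w :=
    { isDense := hdense
      exists_acId := ⟨i, fun v => by simp [acNodes, X]⟩
      leader_mem := hw
      isLeader_iff := fun v hv => ⟨fun h => huniq v ⟨hv, h⟩, fun h => h ▸ hw_leader⟩
      card_le_maxSize := hcard_le
      card_le_maxValue := hcard_le.trans (Nat.le_add_left _ _)
      id_le := fun v => (hid v).le.trans (Nat.le_add_right _ _)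
      acId_lt := fun v j hj => (hacId v j hj).trans_le (Nat.le_add_right _ _) }
  obtain ⟨r, hr, hbound⟩ := exists_failure_bound_le (a := a) hn hcard_le hsize
  have hrun : ∀ ω, (overlayAlgorithm a k n).run G id input ω =
      fun v => ((X.withSeed ω).node X.params.rounds v).output := fun ω =>
    funext fun v => Code.run_toCongest (overlayCode (overlayParams a k n)) _ G id input ω _ v
  simp only [hrun]
  exact (hcluster.unifProb_not_computesOverlay_le (lastTrials_pos (by omega)) hr).trans hbound

theorem one_sub_card_mul_le_prob (A : CongestAlgorithm CliqueInput (ℕ → Option ℕ))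
    (input : V → CliqueInput) {good : ℕ → (V → A.Seed) → Prop} {q : ℝ} (hq : 0 ≤ q)
    (hgood : ∀ i, (acNodes input i).Nonempty → unifProb {ω | ¬ good i ω} ≤ q) :
    1 - Fintype.card V * q ≤ A.prob {ω | ∀ i, (acNodes input i).Nonempty → good i ω} := by
  set ids : Finset ℕ := eraseNone (univ.image fun v => (input v).acId)
  have hmem : ∀ i, i ∈ ids ↔ (acNodes input i).Nonempty := fun i => by
    simp [ids, acNodes, Finset.Nonempty]
  have hids : #ids ≤ Fintype.card V := (card_eraseNone_le _).trans card_image_le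
  have hunion : {ω | ∀ i, (acNodes input i).Nonempty → good i ω} =
      (⋃ i ∈ ids, {ω | ¬ good i ω})ᶜ := by
    ext ω
    simp [hmem]
  have hprob : A.prob (⋃ i ∈ ids, {ω | ¬ good i ω})ᶜ =
      unifProb (⋃ i ∈ ids, {ω | ¬ good i ω})ᶜ := by
    rw [CongestAlgorithm.prob, unifProb, Nat.card_eq_fintype_card]
  rw [hunion, hprob, unifProb_compl, sub_le_sub_iff_left]
  calc unifProb (⋃ i ∈ ids, {ω | ¬ good i ω})
      ≤ ∑ i ∈ ids, unifProb {ω | ¬ good i ω} := unifProb_biUnion_le _ _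
    _ ≤ #ids • q := sum_le_card_nsmul _ _ _ fun i hi => hgood i ((hmem i).1 hi)
    _ ≤ Fintype.card V * q := by rw [nsmul_eq_mul]; gcongr

end Guarantee

end CliqueOverlay

open CliqueOverlay in
theorem mainTheorem7 (a : ℕ) :
    ∃ B : ℝ, ∀ k : ℕ, ∃ (c K : ℝ) (A : ℕ → CongestAlgorithm CliqueInput (ℕ → Option ℕ)),
      0 < c ∧
      (∀ n : ℕ, 3 ≤ n →
        ((A n).rounds : ℝ) ≤ K * Real.log (Real.log (n : ℝ)) ∧
        ((A n).msgBits : ℝ) ≤ B * Real.log (n : ℝ)) ∧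
      ∀ (n : ℕ) (V : Type) [Fintype V] [DecidableEq V] (G : SimpleGraph V) [DecidableRel G.Adj]
        (id : V ↪ ℕ) (input : V → CliqueInput) (ε : ℝ),
        Fintype.card V = n →
        (∀ v, id v < n ^ a) →
        ε ≤ 1 / 15 →
        c * Real.log (n : ℝ) ^ 2 < ε * (G.maxDegree : ℝ) →
        (∀ i, (acNodes input i).Nonempty →
          i < n ^ a ∧ IsAlmostClique G ε (acNodes input i) ∧
          ∃! w, w ∈ acNodes input i ∧ (input w).isLeader = true) →
        1 - 1 / (n : ℝ) ^ k ≤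
          (A n).prob {ω : V → (A n).Seed |
            ∀ i, (acNodes input i).Nonempty →
              ∃ O : Finset (Sym2 V × V),
                IsCliqueOverlay G (acNodes input i) O ∧
                overlayCongestion G O ≤ 2 ∧
                KnowsOverlay G id (acNodes input i) O ((A n).run G id input ω)} := by
  refine ⟨6 * (a + 2), fun k => ?_⟩
  obtain ⟨K, hK⟩ := exists_rounds_le_mul_log_log a k
  refine ⟨216 * (k + 4) ^ 2, K, overlayAlgorithm a k, by positivity,
    fun n hn => ⟨hK n hn, msgBits_le_mul_log (by omega)⟩, ?_⟩
  intro n V _ _ G _ id input ε hcard hid hε hlog hfam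
  have hΔ : G.maxDegree ≠ 0 := fun hΔ => by
    rw [hΔ, Nat.cast_zero, mul_zero] at hlog
    exact hlog.not_ge (by positivity)
  have hn : 2 ≤ n := hcard ▸ two_le_card_of_maxDegree_ne_zero hΔ
  have hacId : ∀ v j, (input v).acId = some j → j < n ^ a := fun v j hj =>
    (hfam j ⟨v, by simpa [acNodes] using hj⟩).1
  have hunion : (Fintype.card V : ℝ) * (1 / n ^ (k + 1)) = 1 / n ^ k := by
    rw [hcard, pow_succ]
    field_simp
  rw [← hunion]
  refine one_sub_card_mul_le_prob _ input (by positivity) fun i hi => ?_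
  obtain ⟨-, hC, hleader⟩ := hfam i hi
  exact unifProb_not_computesOverlay_le id hcard hn hid hacId hleader
    (isDense_of_isAlmostClique hC hε) (mul_size_sq_le_card hC hε hn hlog)
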